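/- **Formulas.** Given sets of proposition symbols $P$ and variables $X$, the constructive $\mu$-formulas are $\varphi ::= P \mid X \mid \bot \mid \top \mid \neg\varphi \mid \varphi\land\varphi \mid \varphi\lor\varphi \mid \varphi\to\varphi \mid \Box\varphi \mid \Diamond\varphi \mid \mu X.\varphi \mid \nu X.\varphi$, where $\mu X.\varphi$ and $\nu X.\varphi$ may be formed only if $X$ is positive in $\varphi$ (every free occurrence of $X$ lies under an even number of negations and left-hand sides of implications). Write $\mathrm{Sub}(\varphi)$ for the set of subformulas and $\eta\in\{\mu,\nu\}$. The formula $\varphi$ is *well-named* if for every $\eta X.\psi\in\mathrm{Sub}(\varphi)$ each free occurrence of $X$ in $\psi$ is in the scope of a $\Box$ or $\Diamond$ inside $\psi$, and every variable $X$ with a bound occurrence in $\varphi$ occurs exactly once in $\varphi$ and has exactly one operator $\eta X$ in $\varphi$. **Models.** A *$\mathsf{CK}$-model* $M=\langle W,W^\bot,\preceq,R,V\rangle$ consists of a set $W$ of worlds, a set $W^\bot\subseteq W$ of fallible worlds, a reflexive transitive relation $\preceq$ and a relation $R$ on $W$, and a valuation $V$ assigning to every proposition symbol $P$ a $\preceq$-upward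 closed set $V(P)$ with $W^\bot\subseteq V(P)\subseteq W$, such that $w\in W^\bot$ and ($w\preceq v$ or $wRv$) imply $v\in W^\bot$. Free variables are treated as proposition symbols, interpreted by arbitrary sets $\rho(X)\subseteq W$. **Truth.** Every formula is true at every fallible world. At a world $w\notin W^\bot$: $P$ is true iff $w\in V(P)$; $X$ is true iff $w\in\rho(X)$; $\bot$ is false and $\top$ is true; $\land,\lor$ are as usual; $\varphi\to\psi$ is true iff every $v\succeq w$ satisfying $\varphi$ satisfies $\psi$; $\neg\varphi$ is true iff no $v\succeq w$ satisfies $\varphi$; $\Box\varphi$ is true iff $\varphi$ is true at $u$ whenever $w\preceq v$ and $vRu$; $\Diamond\varphi$ is true iff for every $v\succeq w$ there is $u$ with $vRu$ satisfying $\varphi$. The truth sets of $\mu X.\varphi$ and $\nu X.\varphi$ are the least and the greatest fixed point of the monotone operator sending $A\subseteq W$ to the truth set of $\varphi$ with $X$ interpreted by $A$. **Game.** The evaluation game $\mathcal G(M,w\models\varphi)$ has players $\mathsf I,\mathsf{II}$, who hold different roles among Verifier $\mathsf V$ and Refuter $\mathsf R$. Positions carry the role $\mathsf Q$ currently held by $\mathsf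 I$; $\bar{\mathsf Q}$ is the other role. Main positions are $\langle v,\psi,\mathsf Q\rangle$ with $\psi\in\mathrm{Sub}(\varphi)$; auxiliary positions are $\langle\langle v\rangle,\psi,\mathsf Q\rangle$, $\langle[v],\psi,\mathsf Q\rangle$ and $\langle v,\theta?\theta',\mathsf Q\rangle$ for $\Diamond\psi$, $\Box\psi$, $\theta\to\theta'\in\mathrm{Sub}(\varphi)$. Play starts at $\langle w,\varphi,\mathsf V\rangle$. A main position with $v\in W^\bot$ belongs to $\mathsf R$ and has no moves. For $v\notin W^\bot$: - $\langle v,\psi,\mathsf Q\rangle$ with $\psi$ a proposition symbol, $\bot$, $\top$ or a free variable of $\varphi$ has no moves, and belongs to $\mathsf R$ if $\psi$ is true at $v$ and to $\mathsf V$ otherwise; - at $\psi\lor\theta$ the role $\mathsf V$, at $\psi\land\theta$ the role $\mathsf R$, chooses a component, at the same $v$ and $\mathsf Q$; - at $\neg\psi$, $\mathsf R$ chooses $u\succeq v$ and moves to $\langle u,\psi,\bar{\mathsf Q}\rangle$; - at $\psi\to\theta$, $\mathsf R$ chooses $u\succeq v$ and moves to $\langle u,\psi?\theta,\mathsf Q\rangle$;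 - at $\Diamond\psi$, $\mathsf R$ chooses $u\succeq v$ and moves to $\langle\langle u\rangle,\psi,\mathsf Q\rangle$; at $\Box\psi$, $\mathsf R$ chooses $u\succeq v$ and moves to $\langle[u],\psi,\mathsf Q\rangle$; - from $\langle v,\eta X.\psi,\mathsf Q\rangle$ the only move is to $\langle v,\psi,\mathsf Q\rangle$; for $X$ bound in $\varphi$ by $\eta X.\psi$, the only move from $\langle v,X,\mathsf Q\rangle$ is to $\langle v,\eta X.\psi,\mathsf Q\rangle$, and then $\eta X.\psi$ is said to be *regenerated*; these positions belong to $\mathsf V$ if $\eta=\nu$ and to $\mathsf R$ if $\eta=\mu$. At auxiliary positions (with $v$ any world): at $\langle v,\psi?\theta,\mathsf Q\rangle$, $\mathsf V$ moves to $\langle v,\psi,\bar{\mathsf Q}\rangle$ or $\langle v,\theta,\mathsf Q\rangle$; at $\langle\langle v\rangle,\psi,\mathsf Q\rangle$ the role $\mathsf V$, at $\langle[v],\psi,\mathsf Q\rangle$ the role $\mathsf R$, chooses $u$ with $vRu$ and moves to $\langle u,\psi,\mathsf Q\rangle$. A run stops only at a position without moves, whose owner loses. The formula $\eta X.\psi$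 is owned by $\mathsf I$ if some $\langle v,\eta X.\psi,\mathsf Q\rangle$ is reachable from the initial position with $\mathsf Q=\mathsf V,\eta=\nu$ or $\mathsf Q=\mathsf R,\eta=\mu$. An infinite run is won by $\mathsf I$ iff $\mathsf I$ owns the outermost infinitely often regenerated fixed-point formula, i.e. the one of which every infinitely often regenerated fixed-point formula is a subformula; otherwise $\mathsf{II}$ wins. A (positional) strategy of a player gives an admissible move at each position which that player owns and which has a move; it is winning if the player wins every run in which they follow it. **Theorem.** Let $M$ be a $\mathsf{CK}$-model, $w$ a world of $M$, $\rho$ an interpretation of the free variables, and $\varphi$ a well-named constructive $\mu$-formula. Then player $\mathsf I$ has a winning strategy in $\mathcal G(M,w\models\varphi)$ if and only if $M,w\models\varphi$, and player $\mathsf{II}$ has a winning strategy in $\mathcal G(M,w\models\varphi)$ if and only if $M,w\not\models\varphi$. -/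

import Mathlib

namespace ConstructiveMu

/-- The two kinds of fixed-point operators. -/
inductive FixKind
  | mu
  | nu

/-- Constructive `μ`-formulas over proposition symbols `At` and variable symbols `Vr`
(before the positivity requirement, see `Formula.WellFormed`). -/
inductive Formula (At Vr : Type*)
  | prop (P : At)
  | var (X : Vr)
  | bot
  | top
  | neg (φ : Formula At Vr)
  | and (φ ψ : Formula At Vr)
  | or (φ ψ : Formula At Vr)
  | imp (φ ψ : Formula At Vr)
  | box (φ : Formula At Vr)
  | dia (φ : Formula At Vr)
  | fix (η : FixKind) (X : Vr) (φ : Formula At Vr)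

namespace Formula

variable {At Vr : Type*}

/-- The set of subformulas. -/
def sub : Formula At Vr → Set (Formula At Vr)
  | prop P => {prop P}
  | var X => {var X}
  | bot => {bot}
  | top => {top}
  | neg φ => insert (neg φ) φ.sub
  | and φ ψ => insert (and φ ψ) (φ.sub ∪ ψ.sub)
  | or φ ψ => insert (or φ ψ) (φ.sub ∪ ψ.sub)
  | imp φ ψ => insert (imp φ ψ) (φ.sub ∪ ψ.sub)
  | box φ => insert (box φ) φ.sub
  | dia φ => insert (dia φ) φ.sub
  | fix η X φ => insert (fix η X φ) φ.sub

/-- `φ.Polar true X`: the variable `X` is positive in `φ`;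
`φ.Polar false X`: the variable `X` is negative in `φ`. -/
def Polar (X : Vr) : Bool → Formula At Vr → Prop
  | _, prop _ => True
  | s, var Y => Y = X → s = true
  | _, bot => True
  | _, top => True
  | s, neg φ => Polar X (!s) φ
  | s, and φ ψ => Polar X s φ ∧ Polar X s ψ
  | s, or φ ψ => Polar X s φ ∧ Polar X s ψ
  | s, imp φ ψ => Polar X (!s) φ ∧ Polar X s ψ
  | s, box φ => Polar X s φ
  | s, dia φ => Polar X s φ
  | s, fix _ Y φ => Y = X ∨ Polar X s φ

/-- Fixed-point formulas `ηX.ψ` may be formed only if `X` is positive in `ψ`. -/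
def WellFormed (φ : Formula At Vr) : Prop :=
  ∀ η X ψ, fix η X ψ ∈ φ.sub → Polar X true ψ

/-- `X` has a free occurrence. -/
def IsFree (X : Vr) : Formula At Vr → Prop
  | prop _ => False
  | var Y => Y = X
  | bot => False
  | top => False
  | neg φ => IsFree X φ
  | and φ ψ => IsFree X φ ∨ IsFree X ψ
  | or φ ψ => IsFree X φ ∨ IsFree X ψ
  | imp φ ψ => IsFree X φ ∨ IsFree X ψ
  | box φ => IsFree X φ
  | dia φ => IsFree X φ
  | fix _ Y φ => Y ≠ X ∧ IsFree X φ

open Classical in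
/-- The number of occurrences (free or bound) of the variable `X`, binders not counted. -/
noncomputable def occ (X : Vr) : Formula At Vr → ℕ
  | prop _ => 0
  | var Y => if Y = X then 1 else 0
  | bot => 0
  | top => 0
  | neg φ => occ X φ
  | and φ ψ => occ X φ + occ X ψ
  | or φ ψ => occ X φ + occ X ψ
  | imp φ ψ => occ X φ + occ X ψ
  | box φ => occ X φ
  | dia φ => occ X φ
  | fix _ _ φ => occ X φ

open Classical in
/-- The number of occurrences of fixed-point operators `μX` and `νX`. -/
noncomputable def binders (X : Vr) : Formula At Vr → ℕ
  | prop _ => 0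
  | var _ => 0
  | bot => 0
  | top => 0
  | neg φ => binders X φ
  | and φ ψ => binders X φ + binders X ψ
  | or φ ψ => binders X φ + binders X ψ
  | imp φ ψ => binders X φ + binders X ψ
  | box φ => binders X φ
  | dia φ => binders X φ
  | fix _ Y φ => (if Y = X then 1 else 0) + binders X φ

/-- Every free occurrence of `X` is in the scope of a modality. -/
def GuardedIn (X : Vr) : Formula At Vr → Prop
  | prop _ => True
  | var Y => Y ≠ X
  | bot => True
  | top => True
  | neg φ => GuardedIn X φ
  | and φ ψ => GuardedIn X φ ∧ GuardedIn X ψ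
  | or φ ψ => GuardedIn X φ ∧ GuardedIn X ψ
  | imp φ ψ => GuardedIn X φ ∧ GuardedIn X ψ
  | box _ => True
  | dia _ => True
  | fix _ Y φ => Y = X ∨ GuardedIn X φ

/-- For all `ηX.ψ` in `Sub(φ)`, `X` is guarded in `ψ`. -/
def Guarded (φ : Formula At Vr) : Prop :=
  ∀ η X ψ, fix η X ψ ∈ φ.sub → GuardedIn X ψ

/-- `X` has an occurrence in the scope of a fixed-point operator `ηX`. -/
def OccursBound (X : Vr) (φ : Formula At Vr) : Prop :=
  ∃ η ψ, fix η X ψ ∈ φ.sub ∧ occ X ψ ≠ 0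

/-- Every variable occurring bound in `φ` occurs only once, and has only one operator `ηX`. -/
def WellBounded (φ : Formula At Vr) : Prop :=
  ∀ X, OccursBound X φ → occ X φ = 1 ∧ binders X φ = 1

def WellNamed (φ : Formula At Vr) : Prop :=
  Guarded φ ∧ WellBounded φ

end Formula

/-- A `CK`-model with set of worlds `W`. -/
structure CKModel (W At : Type*) where
  /-- the set of fallible worlds -/
  fallible : Set W
  /-- the intuitionistic relation -/
  le : W → W → Prop
  /-- the modal relation -/
  R : W → W → Prop
  /-- the valuation -/
  val : At → Set W
  le_refl : ∀ w, le w w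
  le_trans : ∀ u v w, le u v → le v w → le u w
  val_le : ∀ P w v, le w v → w ∈ val P → v ∈ val P
  fallible_val : ∀ P, fallible ⊆ val P
  fallible_le : ∀ w v, w ∈ fallible → le w v → v ∈ fallible
  fallible_R : ∀ w v, w ∈ fallible → R w v → v ∈ fallible

variable {W At Vr : Type*}

open Classical in
/-- `ρ[X ↦ A]`. -/
noncomputable def assign (ρ : Vr → Set W) (X : Vr) (A : Set W) : Vr → Set W :=
  fun Y => if Y = X then A else ρ Y

/-- The least fixed point of a monotone operator. -/
def leastFix (Γ : Set W → Set W) : Set W := ⋂₀ {A | Γ A ⊆ A}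

/-- The greatest fixed point of a monotone operator. -/
def greatestFix (Γ : Set W → Set W) : Set W := ⋃₀ {A | A ⊆ Γ A}

theorem isLeast_leastFix {Γ : Set W → Set W} (h : Monotone Γ) :
    IsLeast {A | Γ A = A} (leastFix Γ) :=
  OrderHom.isLeast_lfp ⟨Γ, h⟩

theorem isGreatest_greatestFix {Γ : Set W → Set W} (h : Monotone Γ) :
    IsGreatest {A | Γ A = A} (greatestFix Γ) :=
  OrderHom.isGreatest_gfp ⟨Γ, h⟩

/-- The truth set `‖φ‖` in the model `M`, with the variables interpreted by `ρ` (free variables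
are treated as proposition symbols). Every formula is true at every fallible world: this is
stipulated in the clauses for variables, negation and diamond, and then holds for all formulas
(`fallible_subset_truth`). -/
noncomputable def truth (M : CKModel W At) : Formula At Vr → (Vr → Set W) → Set W
  | .prop P, _ => M.val P
  | .var X, ρ => M.fallible ∪ ρ X
  | .bot, _ => M.fallible
  | .top, _ => Set.univ
  | .neg φ, ρ => M.fallible ∪ {w | ∀ v, M.le w v → v ∉ truth M φ ρ}
  | .and φ ψ, ρ => truth M φ ρ ∩ truth M ψ ρ
  | .or φ ψ, ρ => truth M φ ρ ∪ truth M ψ ρ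
  | .imp φ ψ, ρ => {w | ∀ v, M.le w v → v ∈ truth M φ ρ → v ∈ truth M ψ ρ}
  | .box φ, ρ => {w | ∀ v u, M.le w v → M.R v u → u ∈ truth M φ ρ}
  | .dia φ, ρ => M.fallible ∪ {w | ∀ v, M.le w v → ∃ u, M.R v u ∧ u ∈ truth M φ ρ}
  | .fix .mu X φ, ρ => leastFix fun A => truth M φ (assign ρ X A)
  | .fix .nu X φ, ρ => greatestFix fun A => truth M φ (assign ρ X A)

theorem fallible_subset_truth (M : CKModel W At) (φ : Formula At Vr) :
    ∀ ρ : Vr → Set W, M.fallible ⊆ truth M φ ρ := by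
  induction φ with
  | prop P => intro ρ; exact M.fallible_val P
  | var X => intro ρ; exact Set.subset_union_left
  | bot => intro ρ; exact subset_rfl
  | top => intro ρ; exact Set.subset_univ _
  | neg φ _ => intro ρ; exact Set.subset_union_left
  | and φ ψ h1 h2 => intro ρ; exact Set.subset_inter (h1 ρ) (h2 ρ)
  | or φ ψ h1 _ => intro ρ; exact (h1 ρ).trans Set.subset_union_left
  | imp φ ψ _ h2 => intro ρ w hw v hv _; exact h2 ρ (M.fallible_le w v hw hv)
  | box φ h =>
    intro ρ w hw v u hv hu
    exact h ρ (M.fallible_R v u (M.fallible_le w v hw hv) hu)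
  | dia φ _ => intro ρ; exact Set.subset_union_left
  | fix η X φ h =>
    intro ρ
    cases η with
    | mu => exact Set.subset_sInter fun A hA => (h _).trans hA
    | nu => exact Set.subset_sUnion_of_mem (h (assign ρ X M.fallible))

theorem assign_assign (ρ : Vr → Set W) (X : Vr) (A B : Set W) :
    assign (assign ρ X A) X B = assign ρ X B := by
  funext Z; by_cases h : Z = X <;> simp [assign, h]

theorem assign_comm (ρ : Vr → Set W) {X Y : Vr} (hXY : Y ≠ X) (A B : Set W) :
    assign (assign ρ X A) Y B = assign (assign ρ Y B) X A := by
  funext Z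
  by_cases h : Z = X
  · subst h; simp [assign, hXY.symm]
  · by_cases h' : Z = Y <;> simp [assign, h, h', hXY]

/-- The truth set is monotone (antitone) in the interpretation of a positive (negative)
variable. -/
theorem truth_assign_mono (M : CKModel W At) (X : Vr) (φ : Formula At Vr) :
    ∀ (ρ : Vr → Set W) {A B : Set W}, A ⊆ B →
      (φ.Polar X true → truth M φ (assign ρ X A) ⊆ truth M φ (assign ρ X B)) ∧
      (φ.Polar X false → truth M φ (assign ρ X B) ⊆ truth M φ (assign ρ X A)) := by
  induction φ with
  | prop P => intro ρ A B _; exact ⟨fun _ => subset_rfl, fun _ => subset_rfl⟩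
  | var Y =>
    intro ρ A B hAB
    by_cases h : Y = X <;> simp [truth, assign, Formula.Polar, h]
    exact hAB.trans Set.subset_union_right
  | bot => intro ρ A B _; exact ⟨fun _ => subset_rfl, fun _ => subset_rfl⟩
  | top => intro ρ A B _; exact ⟨fun _ => subset_rfl, fun _ => subset_rfl⟩
  | neg φ h =>
    intro ρ A B hAB
    exact ⟨fun hp => Set.union_subset_union_right _ fun w hw v hv hv' =>
        hw v hv ((h ρ hAB).2 hp hv'),
      fun hp => Set.union_subset_union_right _ fun w hw v hv hv' =>
        hw v hv ((h ρ hAB).1 hp hv')⟩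
  | and φ ψ h1 h2 =>
    intro ρ A B hAB
    exact ⟨fun hp => Set.inter_subset_inter ((h1 ρ hAB).1 hp.1) ((h2 ρ hAB).1 hp.2),
      fun hp => Set.inter_subset_inter ((h1 ρ hAB).2 hp.1) ((h2 ρ hAB).2 hp.2)⟩
  | or φ ψ h1 h2 =>
    intro ρ A B hAB
    exact ⟨fun hp => Set.union_subset_union ((h1 ρ hAB).1 hp.1) ((h2 ρ hAB).1 hp.2),
      fun hp => Set.union_subset_union ((h1 ρ hAB).2 hp.1) ((h2 ρ hAB).2 hp.2)⟩
  | imp φ ψ h1 h2 =>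
    intro ρ A B hAB
    exact ⟨fun hp w hw v hv hv' => (h2 ρ hAB).1 hp.2 (hw v hv ((h1 ρ hAB).2 hp.1 hv')),
      fun hp w hw v hv hv' => (h2 ρ hAB).2 hp.2 (hw v hv ((h1 ρ hAB).1 hp.1 hv'))⟩
  | box φ h =>
    intro ρ A B hAB
    exact ⟨fun hp w hw v u hv hu => (h ρ hAB).1 hp (hw v u hv hu),
      fun hp w hw v u hv hu => (h ρ hAB).2 hp (hw v u hv hu)⟩
  | dia φ h =>
    intro ρ A B hAB
    exact ⟨fun hp => Set.union_subset_union_right _ fun w hw v hv =>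
        (hw v hv).imp fun u hu => ⟨hu.1, (h ρ hAB).1 hp hu.2⟩,
      fun hp => Set.union_subset_union_right _ fun w hw v hv =>
        (hw v hv).imp fun u hu => ⟨hu.1, (h ρ hAB).2 hp hu.2⟩⟩
  | fix η Y φ h =>
    intro ρ A B hAB
    by_cases hXY : Y = X
    · subst hXY
      cases η <;> simp [truth, assign_assign]
    · have key := fun C => h (assign ρ Y C) hAB
      cases η <;> simp only [truth, assign_comm ρ hXY, Formula.Polar, hXY, false_or]
      · exact ⟨fun hp => Set.sInter_subset_sInter fun C hC => ((key C).1 hp).trans hC,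
          fun hp => Set.sInter_subset_sInter fun C hC => ((key C).2 hp).trans hC⟩
      · exact ⟨fun hp => Set.sUnion_subset_sUnion fun C hC => Set.Subset.trans hC ((key C).1 hp),
          fun hp => Set.sUnion_subset_sUnion fun C hC => Set.Subset.trans hC ((key C).2 hp)⟩

/-- Well-definedness of `‖μX.φ‖` as a least fixed point. -/
theorem truth_mu_isLeast (M : CKModel W At) (X : Vr) (φ : Formula At Vr) (ρ : Vr → Set W)
    (h : φ.Polar X true) :
    IsLeast {A | truth M φ (assign ρ X A) = A} (truth M (.fix .mu X φ) ρ) :=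
  isLeast_leastFix fun _ _ hAB => (truth_assign_mono M X φ ρ hAB).1 h

/-- Well-definedness of `‖νX.φ‖` as a greatest fixed point. -/
theorem truth_nu_isGreatest (M : CKModel W At) (X : Vr) (φ : Formula At Vr) (ρ : Vr → Set W)
    (h : φ.Polar X true) :
    IsGreatest {A | truth M φ (assign ρ X A) = A} (truth M (.fix .nu X φ) ρ) :=
  isGreatest_greatestFix fun _ _ hAB => (truth_assign_mono M X φ ρ hAB).1 h

/-- The roles of Verifier and Refuter. -/
inductive Role
  | V
  | R

/-- The dual role. -/
def Role.dual : Role → Role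
  | .V => .R
  | .R => .V

/-- The two players. -/
inductive Player
  | I
  | II

/-- Positions of the evaluation games; the last component is the role currently held by `I`. -/
inductive Position (W At Vr : Type*)
  /-- the main position `⟨v, ψ, Q⟩` -/
  | main (v : W) (ψ : Formula At Vr) (Q : Role)
  /-- the auxiliary position `⟨⟨v⟩, ψ, Q⟩` -/
  | dia (v : W) (ψ : Formula At Vr) (Q : Role)
  /-- the auxiliary position `⟨[v], ψ, Q⟩` -/
  | box (v : W) (ψ : Formula At Vr) (Q : Role)
  /-- the auxiliary position `⟨v, θ?θ', Q⟩` -/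
  | imp (v : W) (θ θ' : Formula At Vr) (Q : Role)

/-- The role of `I` at a position. -/
def Position.role : Position W At Vr → Role
  | .main _ _ Q => Q
  | .dia _ _ Q => Q
  | .box _ _ Q => Q
  | .imp _ _ _ Q => Q

/-- The positions of the evaluation game of `φ`. -/
def Position.InGame (φ : Formula At Vr) : Position W At Vr → Prop
  | .main _ ψ _ => ψ ∈ φ.sub
  | .dia _ ψ _ => Formula.dia ψ ∈ φ.sub
  | .box _ ψ _ => Formula.box ψ ∈ φ.sub
  | .imp _ θ θ' _ => Formula.imp θ θ' ∈ φ.sub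

/-- The admissible moves. There is no move from `⟨v, ψ, Q⟩` when `v` is fallible or when `ψ` is a
proposition symbol, `⊥`, `⊤` or a free variable of `φ`. -/
inductive Move (M : CKModel W At) (φ : Formula At Vr) : Position W At Vr → Position W At Vr → Prop
  | or_left {v ψ θ Q} : v ∉ M.fallible → Move M φ (.main v (.or ψ θ) Q) (.main v ψ Q)
  | or_right {v ψ θ Q} : v ∉ M.fallible → Move M φ (.main v (.or ψ θ) Q) (.main v θ Q)
  | and_left {v ψ θ Q} : v ∉ M.fallible → Move M φ (.main v (.and ψ θ) Q) (.main v ψ Q)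
  | and_right {v ψ θ Q} : v ∉ M.fallible → Move M φ (.main v (.and ψ θ) Q) (.main v θ Q)
  | neg {v u ψ Q} : v ∉ M.fallible → M.le v u →
      Move M φ (.main v (.neg ψ) Q) (.main u ψ Q.dual)
  | imp {v u ψ θ Q} : v ∉ M.fallible → M.le v u →
      Move M φ (.main v (.imp ψ θ) Q) (.imp u ψ θ Q)
  | imp_left {v ψ θ Q} : Move M φ (.imp v ψ θ Q) (.main v ψ Q.dual)
  | imp_right {v ψ θ Q} : Move M φ (.imp v ψ θ Q) (.main v θ Q)
  | dia {v u ψ Q} : v ∉ M.fallible → M.le v u → Move M φ (.main v (.dia ψ) Q) (.dia u ψ Q)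
  | dia_step {v u ψ Q} : M.R v u → Move M φ (.dia v ψ Q) (.main u ψ Q)
  | box {v u ψ Q} : v ∉ M.fallible → M.le v u → Move M φ (.main v (.box ψ) Q) (.box u ψ Q)
  | box_step {v u ψ Q} : M.R v u → Move M φ (.box v ψ Q) (.main u ψ Q)
  | unfold {v η X ψ Q} : v ∉ M.fallible → Move M φ (.main v (.fix η X ψ) Q) (.main v ψ Q)
  | regenerate {v η X ψ Q} : v ∉ M.fallible → ¬ φ.IsFree X → .fix η X ψ ∈ φ.sub →
      Move M φ (.main v (.var X) Q) (.main v (.fix η X ψ) Q)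

open Classical in
/-- The role which owns the position `⟨v, ψ, Q⟩` for `v` not fallible. -/
noncomputable def formulaOwner (M : CKModel W At) (ρ : Vr → Set W) (φ : Formula At Vr) (v : W) :
    Formula At Vr → Role
  | .prop P => if v ∈ M.val P then .R else .V
  | .var X =>
      if φ.IsFree X then (if v ∈ ρ X then .R else .V)
      else if ∃ ψ, .fix .nu X ψ ∈ φ.sub then .V else .R
  | .bot => .V
  | .top => .R
  | .neg _ => .R
  | .and _ _ => .R
  | .or _ _ => .V
  | .imp _ _ => .R
  | .box _ => .R
  | .dia _ => .R
  | .fix .mu _ _ => .R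
  | .fix .nu _ _ => .V

open Classical in
/-- The role which owns a position. -/
noncomputable def ownerRole (M : CKModel W At) (ρ : Vr → Set W) (φ : Formula At Vr) :
    Position W At Vr → Role
  | .main v ψ _ => if v ∈ M.fallible then .R else formulaOwner M ρ φ v ψ
  | .dia _ _ _ => .V
  | .box _ _ _ => .R
  | .imp _ _ _ _ => .V

open Classical in
/-- The player who owns a position. -/
noncomputable def owner (M : CKModel W At) (ρ : Vr → Set W) (φ : Formula At Vr)
    (p : Position W At Vr) : Player :=
  if ownerRole M ρ φ p = p.role then .I else .II

/-- The initial position `⟨w, φ, V⟩`. -/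
def start (w : W) (φ : Formula At Vr) : Position W At Vr := .main w φ .V

/-- The positions `f 0, …, f n` form a finite run: it starts at the initial position, follows the
admissible moves, and no move is available at the last position. -/
def IsFiniteRun (M : CKModel W At) (w : W) (φ : Formula At Vr) (n : ℕ)
    (f : ℕ → Position W At Vr) : Prop :=
  f 0 = start w φ ∧ (∀ i < n, Move M φ (f i) (f (i + 1))) ∧ ¬ ∃ q, Move M φ (f n) q

/-- The positions `f 0, f 1, …` form an infinite run. -/
def IsInfiniteRun (M : CKModel W At) (w : W) (φ : Formula At Vr)
    (f : ℕ → Position W At Vr) : Prop :=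
  f 0 = start w φ ∧ ∀ i, Move M φ (f i) (f (i + 1))

/-- The fixed-point formula `χ = ηX.ψ` is regenerated infinitely often, that is, the run moves
infinitely often from some `⟨v, X, Q⟩` to `⟨v, ηX.ψ, Q⟩`. -/
def RegeneratedInfinitelyOften (f : ℕ → Position W At Vr) (χ : Formula At Vr) : Prop :=
  ∃ η X ψ, χ = .fix η X ψ ∧
    ∀ N, ∃ n ≥ N, ∃ v Q, f n = .main v (.var X) Q ∧ f (n + 1) = .main v χ Q

/-- `χ` is the outermost infinitely often regenerated fixed-point formula. -/
def IsOutermost (f : ℕ → Position W At Vr) (χ : Formula At Vr) : Prop :=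
  RegeneratedInfinitelyOften f χ ∧ ∀ χ', RegeneratedInfinitelyOften f χ' → χ' ∈ χ.sub

/-- The fixed-point formula `χ` is owned by `I`: some position `⟨v, χ, Q⟩` is reachable from the
initial position, with `Q = V` and `χ = νX.ψ`, or `Q = R` and `χ = μX.ψ`. -/
def FixOwnedByI (M : CKModel W At) (w : W) (φ χ : Formula At Vr) : Prop :=
  ∃ v Q X ψ, Relation.ReflTransGen (Move M φ) (start w φ) (.main v χ Q) ∧
    ((Q = .V ∧ χ = .fix .nu X ψ) ∨ (Q = .R ∧ χ = .fix .mu X ψ))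

/-- The winning condition for infinite runs: `I` wins iff `I` owns the outermost infinitely often
regenerated fixed-point formula, otherwise `II` wins. -/
def WinsInfinite (M : CKModel W At) (w : W) (φ : Formula At Vr) (f : ℕ → Position W At Vr) :
    Player → Prop
  | .I => ∃ χ, IsOutermost f χ ∧ FixOwnedByI M w φ χ
  | .II => ¬ ∃ χ, IsOutermost f χ ∧ FixOwnedByI M w φ χ

/-- `σ` is a (positional) strategy for the player `π`: at every position owned by `π` from which
some move is available, `σ` gives an admissible move. -/
def IsStrategy (M : CKModel W At) (ρ : Vr → Set W) (φ : Formula At Vr) (π : Player)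
    (σ : Position W At Vr → Position W At Vr) : Prop :=
  ∀ p, p.InGame φ → owner M ρ φ p = π → (∃ q, Move M φ p q) → Move M φ p (σ p)

/-- `π` has a winning strategy in the evaluation game `G(M, w ⊨ φ)`, where free variables are
treated as proposition symbols with valuation `ρ`. The owner of the last position of a finite run
loses. -/
def HasWinningStrategy (M : CKModel W At) (ρ : Vr → Set W) (w : W) (φ : Formula At Vr)
    (π : Player) : Prop :=
  ∃ σ, IsStrategy M ρ φ π σ ∧
    (∀ n f, IsFiniteRun M w φ n f →
      (∀ i < n, owner M ρ φ (f i) = π → f (i + 1) = σ (f i)) → owner M ρ φ (f n) ≠ π) ∧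
    (∀ f, IsInfiniteRun M w φ f →
      (∀ i, owner M ρ φ (f i) = π → f (i + 1) = σ (f i)) → WinsInfinite M w φ f π)

end ConstructiveMu

/-! Fix a player `π` and call a position good if its formula has there the truth value that the role
of `π` asks for: true for Verifier, false for Refuter. It is enough that each player wins from good
initial positions, since the two players cannot both have winning strategies
(`not_both_hasWinningStrategy`).

A subformula `ψ` of `φ` may contain variables bound outside it. The induction on `ψ` therefore runs
over all interpretations and treats free variables as exits: from a good position `π` can, inside
the positions of `ψ`, win or reach a good free variable (`mem_region_of_isGood`). Connectives and
modalities cost one or two moves. For `μ` with `π` Verifier, the worlds already won form a prefixed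
point, so they contain the least fixed point; `ν` with `π` Refuter is dual. For `ν` with `π`
Verifier, or `μ` with `π` Refuter, interpret `X` by the fixed point itself: play returns to `X` only
at good positions, and if it does so infinitely often without leaving `ηX.ψ`, then `ηX.ψ` is the
outermost regenerated formula and its kind favours `π`. No ordinal approximants are needed.

These local strategies are glued by general facts on games with exits: the winning region is
monotone in the exit set, contains it, and is idempotent (`winSet_winSet`). Idempotence rests on one
positional strategy that serves the whole region (`exists_isTrap_winSet`).

Finally, ownership of a fixed-point formula refers to some reachable position. A bound variable
occurs once and positively, so a regenerated formula is always met in the same role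
(`role_eq_of_reachable`), and the position chosen does not matter. -/

namespace ConstructiveMu

/-! ### Graph games with exits and positional strategies -/

section Trap

variable {α : Type*} {Mv : α → α → Prop} {Own : Set α} {G : (ℕ → α) → Prop} {D D' E E' U : Set α}
  {σ : α → α}

/-- In the graph game with moves `Mv`, the player who owns `Own` and follows `σ` keeps every play
that starts in `U` inside `U`, until it possibly reaches the exit set `E`; before that, the play
stays in `D`, the player is never stuck, and infinite plays satisfy `G`. -/
structure IsTrap (Mv : α → α → Prop) (Own : Set α) (G : (ℕ → α) → Prop) (D E U : Set α)
    (σ : α → α) : Prop where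
  dom : ∀ p ∈ U, p ∉ E → p ∈ D
  own : ∀ p ∈ U, p ∉ E → p ∈ Own → Mv p (σ p) ∧ σ p ∈ U
  opp : ∀ p ∈ U, p ∉ E → p ∉ Own → ∀ q, Mv p q → q ∈ U
  good : ∀ f : ℕ → α, (∀ i, f i ∈ U ∧ f i ∉ E) → (∀ i, Mv (f i) (f (i + 1))) →
    (∀ i, f i ∈ Own → f (i + 1) = σ (f i)) → G f

/-- The positions from which the owner of `Own` can win, or reach `E`, inside `D`. -/
def winSet (Mv : α → α → Prop) (Own : Set α) (G : (ℕ → α) → Prop) (D E : Set α) : Set α :=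
  {p | ∃ U σ, IsTrap Mv Own G D E U σ ∧ p ∈ U}

theorem IsTrap.next (h : IsTrap Mv Own G D E U σ) {p q : α} (hp : p ∈ U) (hE : p ∉ E)
    (hm : Mv p q) (hf : p ∈ Own → q = σ p) : q ∈ U := by
  by_cases ho : p ∈ Own
  · rw [hf ho]; exact (h.own p hp hE ho).2
  · exact h.opp p hp hE ho q hm

theorem IsTrap.mono (h : IsTrap Mv Own G D E U σ) (hD : D ⊆ D') (hE : E ⊆ E') :
    IsTrap Mv Own G D' E' U σ where
  dom p hp hpE := hD (h.dom p hp fun x => hpE (hE x))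
  own p hp hpE := h.own p hp fun x => hpE (hE x)
  opp p hp hpE := h.opp p hp fun x => hpE (hE x)
  good f hf := h.good f fun i => ⟨(hf i).1, fun x => (hf i).2 (hE x)⟩

theorem winSet_mono (hD : D ⊆ D') (hE : E ⊆ E') :
    winSet Mv Own G D E ⊆ winSet Mv Own G D' E' :=
  fun _ ⟨U, σ, h, hp⟩ => ⟨U, σ, h.mono hD hE, hp⟩

theorem subset_winSet : E ⊆ winSet Mv Own G D E := fun _ hp =>
  ⟨E, id, ⟨fun _ h h' => (h' h).elim, fun _ h h' => (h' h).elim, fun _ h h' => (h' h).elim,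
    fun _ h => ((h 0).2 (h 0).1).elim⟩, hp⟩

/-- A single strategy is good on the whole winning set. -/
theorem exists_isTrap_winSet (hG : ∀ f n, G (fun i => f (n + i)) → G f) :
    ∃ σ, IsTrap Mv Own G D E (winSet Mv Own G D E) σ := by
  classical
  -- Well-order all traps and let each position follow the strategy of the least trap containing it.
  let ι := {x : Set α × (α → α) // IsTrap Mv Own G D E x.1 x.2}
  have wf : WellFounded (WellOrderingRel : ι → ι → Prop) := IsWellFounded.wf
  have hne : ∀ p ∈ winSet Mv Own G D E, ({x : ι | p ∈ x.1.1} : Set ι).Nonempty :=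
    fun p ⟨U, σ, h, hp⟩ => ⟨⟨(U, σ), h⟩, hp⟩
  let idx : ∀ p, p ∈ winSet Mv Own G D E → ι := fun p hp => wf.min _ (hne p hp)
  have idx_mem : ∀ p hp, p ∈ (idx p hp).1.1 := fun p hp => wf.min_mem _ (hne p hp)
  have idx_le : ∀ p hp (x : ι), p ∈ x.1.1 → ¬ WellOrderingRel x (idx p hp) :=
    fun p hp x hx => wf.not_lt_min _ hx
  have sub : ∀ x : ι, x.1.1 ⊆ winSet Mv Own G D E := fun x p hp => ⟨x.1.1, x.1.2, x.2, hp⟩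
  let σ : α → α := fun p => if hp : p ∈ winSet Mv Own G D E then (idx p hp).1.2 p else p
  have hσ : ∀ p hp, σ p = (idx p hp).1.2 p := fun p hp => dif_pos hp
  refine ⟨σ, ⟨fun p hp hE => (idx p hp).2.dom p (idx_mem p hp) hE, fun p hp hE ho => ?_,
    fun p hp hE ho q hq => sub _ ((idx p hp).2.opp p (idx_mem p hp) hE ho q hq),
    fun f hf hm hs => ?_⟩⟩
  · rw [hσ p hp]
    have h := (idx p hp).2.own p (idx_mem p hp) hE ho
    exact ⟨h.1, sub _ h.2⟩
  · let g : ℕ → ι := fun i => idx (f i) (hf i).1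
    have gne : (Set.range g).Nonempty := ⟨g 0, 0, rfl⟩
    obtain ⟨N, hN⟩ := wf.min_mem _ gne
    have next : ∀ i, f (i + 1) ∈ (g i).1.1 := fun i =>
      (g i).2.next (idx_mem _ (hf i).1) (hf i).2 (hm i) fun ho => by rw [hs i ho, hσ _ (hf i).1]
    -- The next position still lies in the current trap, so the least index never increases along
    -- the play. Once it attains its minimum, a single trap governs the whole tail, and `hG`
    -- transfers `G` from the tail to the play.
    have const : ∀ i, g (N + i) = g N := by
      intro i
      induction i with
      | zero => rfl
      | succ i ih =>
        rcases trichotomous_of WellOrderingRel (g (N + (i + 1))) (g N) with h | h | h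
        · rw [hN] at h
          exact (wf.not_lt_min (Set.range g) (Set.mem_range_self (N + (i + 1))) h).elim
        · exact h
        · rw [← ih] at h
          exact (idx_le _ (hf (N + i + 1)).1 _ (next (N + i)) h).elim
    refine hG f N ((g N).2.good (fun i => f (N + i)) (fun i => ⟨?_, (hf _).2⟩) (fun i => hm _)
      fun i ho => ?_)
    · rw [← const i]; exact idx_mem _ (hf (N + i)).1
    · have := hs (N + i) ho
      rw [hσ _ (hf _).1] at this
      rw [← const i]; exact this

/-- Follow the outer strategy until the inner winning set is entered, and its uniform strategy from
then on; the play never leaves that set before reaching `E`. -/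
theorem winSet_winSet (hG : ∀ f n, G (fun i => f (n + i)) → G f) :
    winSet Mv Own G D (winSet Mv Own G D E) ⊆ winSet Mv Own G D E := by
  classical
  obtain ⟨σ₂, h₂⟩ := exists_isTrap_winSet (Mv := Mv) (Own := Own) (D := D) (E := E) hG
  rintro p ⟨U, σ₁, h₁, hp⟩
  set V := winSet Mv Own G D E
  refine ⟨U ∪ V, fun p => if p ∈ V then σ₂ p else σ₁ p, ⟨?_, ?_, ?_, ?_⟩, Or.inl hp⟩
  · intro q hq hE
    by_cases hV : q ∈ V
    · exact h₂.dom q hV hE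
    · exact h₁.dom q (hq.resolve_right hV) hV
  · intro q hq hE ho
    by_cases hV : q ∈ V
    · simp only [hV, if_true]
      exact ⟨(h₂.own q hV hE ho).1, Or.inr (h₂.own q hV hE ho).2⟩
    · simp only [hV, if_false]
      have := h₁.own q (hq.resolve_right hV) hV ho
      exact ⟨this.1, Or.inl this.2⟩
  · intro q hq hE ho r hr
    by_cases hV : q ∈ V
    · exact Or.inr (h₂.opp q hV hE ho r hr)
    · exact Or.inl (h₁.opp q (hq.resolve_right hV) hV ho r hr)
  · intro f hf hm hs
    by_cases hV : ∃ n, f n ∈ V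
    · obtain ⟨n, hn⟩ := hV
      have stay : ∀ i, f (n + i) ∈ V := by
        intro i
        induction i with
        | zero => exact hn
        | succ i ih =>
          exact h₂.next ih (hf _).2 (hm (n + i)) fun ho =>
            (hs (n + i) ho).trans (if_pos ih)
      exact hG f n (h₂.good _ (fun i => ⟨stay i, (hf _).2⟩) (fun i => hm _)
        fun i ho => (hs (n + i) ho).trans (if_pos (stay i)))
    · push Not at hV
      exact h₁.good f (fun i => ⟨(hf i).1.resolve_right (hV i), hV i⟩) hm
        fun i ho => by simpa [hV i] using hs i ho

theorem mem_winSet_of_step (hG : ∀ f n, G (fun i => f (n + i)) → G f) {p : α} (hp : p ∈ D)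
    (hown : p ∈ Own → ∃ q, Mv p q ∧ q ∈ winSet Mv Own G D E)
    (hopp : p ∉ Own → ∀ q, Mv p q → q ∈ winSet Mv Own G D E) : p ∈ winSet Mv Own G D E := by
  classical
  set V := winSet Mv Own G D E with hV
  have : ∃ r, p ∈ Own → Mv p r ∧ r ∈ V := by
    by_cases ho : p ∈ Own
    · obtain ⟨q, hq⟩ := hown ho; exact ⟨q, fun _ => hq⟩
    · exact ⟨p, fun h => (ho h).elim⟩
  obtain ⟨r, hr⟩ := this
  refine winSet_winSet hG ⟨{p} ∪ V, fun _ => r, ⟨?_, ?_, ?_, ?_⟩, Or.inl rfl⟩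
  · rintro q (rfl | hq) hE
    · exact hp
    · exact (hE hq).elim
  · rintro q (rfl | hq) hE ho
    · exact ⟨(hr ho).1, Or.inr (hr ho).2⟩
    · exact (hE hq).elim
  · rintro q (rfl | hq) hE ho s hs
    · exact Or.inr (hopp ho s hs)
    · exact (hE hq).elim
  -- There is no infinite play to judge here: the second position is already in the exit set `V`.
  · intro f hf hm hs
    have h0 : f 0 = p := (hf 0).1.resolve_right (hf 0).2
    refine ((hf 1).2 ?_).elim
    by_cases ho : p ∈ Own
    · have := hs 0 (by rwa [h0])
      rw [this]; exact (hr ho).2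
    · exact hopp ho _ (h0 ▸ hm 0)

/-- This turns "win, exit or return to `S`" into "win or exit". A play visiting `S` infinitely often
is good by `hgood`; otherwise some tail avoids `S` and follows the trap strategy throughout. On `S`
any move will do, since all successors are in the winning set. -/
theorem subset_winSet_of_recurrent (hG : ∀ f n, G (fun i => f (n + i)) → G f) {S : Set α}
    (hS : S ⊆ D) (hne : ∀ p ∈ S, ∃ q, Mv p q)
    (hnext : ∀ p ∈ S, ∀ q, Mv p q → q ∈ winSet Mv Own G D (E ∪ S))
    (hgood : ∀ f : ℕ → α, (∀ i, f i ∈ D) → (∀ i, Mv (f i) (f (i + 1))) →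
      (∀ N, ∃ n ≥ N, f n ∈ S) → G f) : S ⊆ winSet Mv Own G D E := by
  classical
  obtain ⟨σ, h⟩ := exists_isTrap_winSet (Mv := Mv) (Own := Own) (D := D) (E := E ∪ S) hG
  set V := winSet Mv Own G D (E ∪ S)
  have key : ∀ p, p ∉ E → p ∉ S → p ∉ E ∪ S := fun p h1 h2 h3 => h3.elim h1 h2
  intro p hp
  refine ⟨V, fun q => if hq : q ∈ S then (hne q hq).choose else σ q, ⟨?_, ?_, ?_, ?_⟩,
    subset_winSet (Or.inr hp)⟩
  · intro q hq hE
    by_cases hqS : q ∈ S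
    · exact hS hqS
    · exact h.dom q hq (key q hE hqS)
  · intro q hq hE ho
    by_cases hqS : q ∈ S
    · simp only [hqS, dif_pos]
      exact ⟨(hne q hqS).choose_spec, hnext q hqS _ (hne q hqS).choose_spec⟩
    · simp only [hqS, dif_neg, not_false_eq_true]
      exact h.own q hq (key q hE hqS) ho
  · intro q hq hE ho r hr
    by_cases hqS : q ∈ S
    · exact hnext q hqS r hr
    · exact h.opp q hq (key q hE hqS) ho r hr
  · intro f hf hm hs
    by_cases hinf : ∀ N, ∃ n ≥ N, f n ∈ S
    · refine hgood f (fun i => ?_) hm hinf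
      by_cases hqS : f i ∈ S
      · exact hS hqS
      · exact h.dom _ (hf i).1 (key _ (hf i).2 hqS)
    · push Not at hinf
      obtain ⟨N, hN⟩ := hinf
      have hN' : ∀ i, f (N + i) ∉ S := fun i => hN _ (Nat.le_add_right _ _)
      exact hG f N (h.good _ (fun i => ⟨(hf _).1, key _ (hf _).2 (hN' i)⟩) (fun i => hm _)
        fun i ho => (hs (N + i) ho).trans (dif_neg (hN' i)))

end Trap

/-! ### Subformulas, binders and occurrences -/

namespace Formula

variable {At Vr : Type*}

theorem mem_sub_self (φ : Formula At Vr) : φ ∈ φ.sub := by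
  cases φ <;> simp [sub]

theorem sub_trans {φ ψ θ : Formula At Vr} (h : ψ ∈ φ.sub) (h' : θ ∈ ψ.sub) : θ ∈ φ.sub := by
  induction φ with
  | prop | var | bot | top => simp only [sub, Set.mem_singleton_iff] at h; subst h; exact h'
  | neg _ ih | box _ ih | dia _ ih | fix _ _ _ ih =>
    rcases h with rfl | h
    · exact h'
    · exact Or.inr (ih h)
  | and _ _ ih₁ ih₂ | or _ _ ih₁ ih₂ | imp _ _ ih₁ ih₂ =>
    rcases h with rfl | h | h
    · exact h'
    · exact Or.inr (Or.inl (ih₁ h))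
    · exact Or.inr (Or.inr (ih₂ h))

theorem eq_or_sizeOf_lt_of_mem_sub {φ ψ : Formula At Vr} (h : ψ ∈ φ.sub) :
    ψ = φ ∨ sizeOf ψ < sizeOf φ := by
  induction φ with
  | prop | var | bot | top => exact Or.inl h
  | neg _ ih | box _ ih | dia _ ih | fix _ _ _ ih =>
    rcases h with h | h
    · exact Or.inl h
    · right
      rcases ih h with rfl | h <;> simp
      omega
  | and _ _ ih₁ ih₂ | or _ _ ih₁ ih₂ | imp _ _ ih₁ ih₂ =>
    rcases h with h | h | h
    · exact Or.inl h
    · right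
      rcases ih₁ h with rfl | h <;> simp <;> omega
    · right
      rcases ih₂ h with rfl | h <;> simp
      omega

theorem sub_antisymm {φ ψ : Formula At Vr} (h : ψ ∈ φ.sub) (h' : φ ∈ ψ.sub) : ψ = φ := by
  rcases eq_or_sizeOf_lt_of_mem_sub h with h | h
  · exact h
  · rcases eq_or_sizeOf_lt_of_mem_sub h' with h' | h'
    · exact h'.symm
    · omega

theorem IsFree.var_mem_sub {X : Vr} {φ : Formula At Vr} (h : φ.IsFree X) : var X ∈ φ.sub := by
  induction φ <;> simp_all [IsFree, sub] <;> tauto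

theorem IsFree.one_le_occ {X : Vr} {φ : Formula At Vr} (h : φ.IsFree X) : 1 ≤ occ X φ := by
  induction φ <;> simp_all [IsFree, occ] <;> first | done | omega | grind

theorem occ_le_of_mem_sub (X : Vr) {φ ψ : Formula At Vr} (h : ψ ∈ φ.sub) :
    occ X ψ ≤ occ X φ := by
  induction φ <;> simp_all [occ, sub] <;> grind [occ]

theorem one_le_binders {η : FixKind} {X : Vr} {φ ψ : Formula At Vr} (h : fix η X ψ ∈ φ.sub) :
    1 ≤ binders X φ := by
  induction φ <;> simp_all [binders, sub] <;> grind [binders]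

/-- Different binders of `X` would be counted separately, either in two branches or one inside the
other. This makes the target of a regeneration unique. -/
theorem fix_unique {η η' : FixKind} {X : Vr} {φ ψ ψ' : Formula At Vr} (hb : binders X φ ≤ 1)
    (h : fix η X ψ ∈ φ.sub) (h' : fix η' X ψ' ∈ φ.sub) : fix η X ψ = fix η' X ψ' := by
  induction φ with
  | prop | var | bot | top => simp [sub] at h
  | neg _ ih | box _ ih | dia _ ih =>
    simp only [sub, Set.mem_insert_iff, reduceCtorEq, false_or] at h h'
    exact ih hb h h'
  | and _ _ ih₁ ih₂ | or _ _ ih₁ ih₂ | imp _ _ ih₁ ih₂ =>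
    simp only [sub, Set.mem_insert_iff, reduceCtorEq, false_or, Set.mem_union] at h h'
    simp only [binders] at hb
    rcases h with h | h <;> rcases h' with h' | h' <;>
      have := one_le_binders h <;> have := one_le_binders h'
    · exact ih₁ (by omega) h h'
    · omega
    · omega
    · exact ih₂ (by omega) h h'
  | fix ζ Y θ ih =>
    simp only [sub, Set.mem_insert_iff] at h h'
    simp only [binders] at hb
    rcases h with h | h <;> rcases h' with h' | h'
    · exact h.trans h'.symm
    · have := one_le_binders h'
      injection h with _ h _
      rw [if_pos h.symm] at hb
      omega
    · have := one_le_binders h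
      injection h' with _ h' _
      rw [if_pos h'.symm] at hb
      omega
    · exact ih (by omega) h h'

/-- The occurrence below the binder and the free one are distinct. Hence a variable with a single
occurrence, lying below its binder, is not free. -/
theorem two_le_occ {η : FixKind} {X : Vr} {φ ψ : Formula At Vr} (h : fix η X ψ ∈ φ.sub)
    (ho : 1 ≤ occ X ψ) (hf : φ.IsFree X) : 2 ≤ occ X φ := by
  induction φ with
  | prop | var | bot | top => simp [sub] at h
  | neg _ ih | box _ ih | dia _ ih =>
    simp only [sub, Set.mem_insert_iff, reduceCtorEq, false_or] at h
    exact ih h hf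
  | and _ _ ih₁ ih₂ | or _ _ ih₁ ih₂ | imp _ _ ih₁ ih₂ =>
    simp only [sub, Set.mem_insert_iff, reduceCtorEq, false_or, Set.mem_union] at h
    simp only [occ]
    rcases h with h | h <;> rcases hf with hf | hf <;>
      have := occ_le_of_mem_sub X h <;> have := hf.one_le_occ <;> simp only [occ] at *
    · have := ih₁ h hf; omega
    · omega
    · omega
    · have := ih₂ h hf; omega
  | fix ζ Y θ ih =>
    rcases h with h | h
    · injection h with _ h _
      exact (hf.1 h.symm).elim
    · exact ih h hf.2

theorem isFree_or_exists_fix {X : Vr} {φ : Formula At Vr} (h : var X ∈ φ.sub) :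
    φ.IsFree X ∨ ∃ η ψ, fix η X ψ ∈ φ.sub ∧ ψ.IsFree X := by
  induction φ with
  | fix η Y θ ih =>
    simp only [sub, Set.mem_insert_iff, reduceCtorEq, false_or] at h
    rcases ih h with h | ⟨ζ, ψ, h, h'⟩
    · by_cases hY : Y = X
      · subst hY; exact Or.inr ⟨η, θ, mem_sub_self _, h⟩
      · exact Or.inl ⟨hY, h⟩
    · exact Or.inr ⟨ζ, ψ, Or.inr h, h'⟩
  | _ => simp_all [IsFree, sub] <;> grind

/-- Consequences of well-namedness for a binder `ηX.ψ` with `X` free in `ψ`. -/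
theorem WellBounded.of_isFree {φ : Formula At Vr} (hφ : φ.WellBounded) {η : FixKind} {X : Vr}
    {ψ : Formula At Vr} (h : fix η X ψ ∈ φ.sub) (hf : ψ.IsFree X) :
    occ X φ = 1 ∧ ¬ φ.IsFree X ∧ ∀ η' ψ', fix η' X ψ' ∈ φ.sub → fix η' X ψ' = fix η X ψ := by
  have ho := hf.one_le_occ
  obtain ⟨h1, h2⟩ := hφ X ⟨η, ψ, h, by omega⟩
  refine ⟨h1, fun hF => ?_, fun η' ψ' h' => fix_unique (by omega) h' h⟩
  have := two_le_occ h ho hF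
  omega

/-! ### Occurrences and the roles in which they are evaluated -/

/-- `OccursAt χ φ Q Q'`: some occurrence of `χ` in `φ` is evaluated in the role `Q'` when `φ` is
evaluated in the role `Q`. -/
def OccursAt (χ : Formula At Vr) : Formula At Vr → Role → Role → Prop
  | prop P, Q, Q' => χ = prop P ∧ Q' = Q
  | var X, Q, Q' => χ = var X ∧ Q' = Q
  | bot, Q, Q' => χ = bot ∧ Q' = Q
  | top, Q, Q' => χ = top ∧ Q' = Q
  | neg φ, Q, Q' => (χ = neg φ ∧ Q' = Q) ∨ OccursAt χ φ Q.dual Q'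
  | and φ ψ, Q, Q' => (χ = and φ ψ ∧ Q' = Q) ∨ OccursAt χ φ Q Q' ∨ OccursAt χ ψ Q Q'
  | or φ ψ, Q, Q' => (χ = or φ ψ ∧ Q' = Q) ∨ OccursAt χ φ Q Q' ∨ OccursAt χ ψ Q Q'
  | imp φ ψ, Q, Q' => (χ = imp φ ψ ∧ Q' = Q) ∨ OccursAt χ φ Q.dual Q' ∨ OccursAt χ ψ Q Q'
  | box φ, Q, Q' => (χ = box φ ∧ Q' = Q) ∨ OccursAt χ φ Q Q'
  | dia φ, Q, Q' => (χ = dia φ ∧ Q' = Q) ∨ OccursAt χ φ Q Q'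
  | fix η X φ, Q, Q' => (χ = fix η X φ ∧ Q' = Q) ∨ OccursAt χ φ Q Q'

/-- `φ.FreeAt X Q Q'`: some free occurrence of `X` in `φ` is evaluated in the role `Q'` when `φ` is
evaluated in the role `Q`. -/
def FreeAt (X : Vr) : Formula At Vr → Role → Role → Prop
  | prop _, _, _ => False
  | var Y, Q, Q' => Y = X ∧ Q' = Q
  | bot, _, _ => False
  | top, _, _ => False
  | neg φ, Q, Q' => FreeAt X φ Q.dual Q'
  | and φ ψ, Q, Q' => FreeAt X φ Q Q' ∨ FreeAt X ψ Q Q'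
  | or φ ψ, Q, Q' => FreeAt X φ Q Q' ∨ FreeAt X ψ Q Q'
  | imp φ ψ, Q, Q' => FreeAt X φ Q.dual Q' ∨ FreeAt X ψ Q Q'
  | box φ, Q, Q' => FreeAt X φ Q Q'
  | dia φ, Q, Q' => FreeAt X φ Q Q'
  | fix _ Y φ, Q, Q' => Y ≠ X ∧ FreeAt X φ Q Q'

theorem occursAt_self (φ : Formula At Vr) (Q : Role) : φ.OccursAt φ Q Q := by
  cases φ <;> simp [OccursAt]

theorem OccursAt.trans {χ ψ φ : Formula At Vr} {Q Q' Q'' : Role} (h : OccursAt ψ φ Q Q')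
    (h' : OccursAt χ ψ Q' Q'') : OccursAt χ φ Q Q'' := by
  induction φ generalizing Q with
  | prop | var | bot | top => obtain ⟨rfl, rfl⟩ := h; exact h'
  | neg _ ih | box _ ih | dia _ ih | fix _ _ _ ih =>
    rcases h with ⟨rfl, rfl⟩ | h
    · exact h'
    · exact Or.inr (ih h)
  | and _ _ ih₁ ih₂ | or _ _ ih₁ ih₂ | imp _ _ ih₁ ih₂ =>
    rcases h with ⟨rfl, rfl⟩ | h | h
    · exact h'
    · exact Or.inr (Or.inl (ih₁ h))
    · exact Or.inr (Or.inr (ih₂ h))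

theorem exists_occursAt {χ φ : Formula At Vr} (h : χ ∈ φ.sub) (Q : Role) :
    ∃ Q', OccursAt χ φ Q Q' := by
  induction φ generalizing Q with
  | prop | var | bot | top => exact ⟨Q, h, rfl⟩
  | neg _ ih | box _ ih | dia _ ih | fix _ _ _ ih =>
    rcases h with rfl | h
    · exact ⟨Q, occursAt_self _ _⟩
    · exact (ih h _).imp fun _ => Or.inr
  | and _ _ ih₁ ih₂ | or _ _ ih₁ ih₂ | imp _ _ ih₁ ih₂ =>
    rcases h with rfl | h | h
    · exact ⟨Q, occursAt_self _ _⟩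
    · exact (ih₁ h _).imp fun _ h => Or.inr (Or.inl h)
    · exact (ih₂ h _).imp fun _ h => Or.inr (Or.inr h)

theorem OccursAt.one_le_occ {X : Vr} {φ : Formula At Vr} {Q Q' : Role}
    (h : OccursAt (var X) φ Q Q') : 1 ≤ occ X φ := by
  induction φ generalizing Q <;> simp_all [OccursAt, occ] <;> grind

/-- A role is attached to an occurrence, and there is only one; occurrences in both branches of a
connective would count twice. -/
theorem OccursAt.unique {X : Vr} {φ : Formula At Vr} {Q Q₁ Q₂ : Role} (ho : occ X φ ≤ 1)
    (h₁ : OccursAt (var X) φ Q Q₁) (h₂ : OccursAt (var X) φ Q Q₂) : Q₁ = Q₂ := by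
  induction φ generalizing Q with
  | prop | var | bot | top => exact h₁.2.trans h₂.2.symm
  | neg _ ih | box _ ih | dia _ ih | fix _ _ _ ih =>
    simp only [OccursAt, reduceCtorEq, false_and, false_or] at h₁ h₂
    exact ih ho h₁ h₂
  | and _ _ ih₁ ih₂ | or _ _ ih₁ ih₂ | imp _ _ ih₁ ih₂ =>
    simp only [OccursAt, reduceCtorEq, false_and, false_or] at h₁ h₂
    simp only [occ] at ho
    rcases h₁ with h₁ | h₁ <;> rcases h₂ with h₂ | h₂ <;>
      have := h₁.one_le_occ <;> have := h₂.one_le_occ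
    · exact ih₁ (by omega) h₁ h₂
    · omega
    · omega
    · exact ih₂ (by omega) h₁ h₂

theorem FreeAt.isFree {X : Vr} {φ : Formula At Vr} {Q Q' : Role} (h : φ.FreeAt X Q Q') :
    φ.IsFree X := by
  induction φ generalizing Q <;> simp_all [FreeAt, IsFree] <;> grind

theorem _root_.ConstructiveMu.Role.dual_dual (Q : Role) : Q.dual.dual = Q := by cases Q <;> rfl

/-- Negations and left-hand sides of implications flip the polarity flag and the role together, so
positivity of `X` means that `X` is reached in the role of `φ`. -/
theorem FreeAt.eq_of_polar {X : Vr} {φ : Formula At Vr} {Q Q' : Role} (h : φ.FreeAt X Q Q') :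
    (φ.Polar X true → Q' = Q) ∧ (φ.Polar X false → Q' = Q.dual) := by
  induction φ generalizing Q <;> simp_all [FreeAt, Polar] <;> grind [Role.dual_dual]

theorem IsFree.occursAt_of_polar {X : Vr} {φ : Formula At Vr} (h : φ.IsFree X) (Q : Role) :
    (φ.Polar X true → OccursAt (var X) φ Q Q) ∧
      (φ.Polar X false → OccursAt (var X) φ Q Q.dual) := by
  induction φ generalizing Q <;> simp_all [IsFree, OccursAt, Polar] <;> grind [Role.dual_dual]

end Formula

open Formula

/-! ### Winning regions and truth sets -/

section Region

variable {W At Vr : Type*} {M : CKModel W At} {ρ ρ' : Vr → Set W} {φ ψ θ : Formula At Vr}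
  {π : Player} {D E : Set (Position W At Vr)} {v w : W} {Q Q' : Role}

/-- The role held by the player `π` when `I` holds the role `Q`. -/
def Player.role : Player → Role → Role
  | .I, Q => Q
  | .II, Q => Q.dual

theorem Player.role_dual_eq_V {π : Player} {Q : Role} : π.role Q.dual = .V ↔ π.role Q ≠ .V := by
  cases π <;> cases Q <;> simp [Player.role, Role.dual]

theorem Role.eq_R_iff {Q : Role} : Role.R = Q ↔ Q ≠ .V := by cases Q <;> simp

theorem owner_eq_iff (p : Position W At Vr) :
    owner M ρ φ p = π ↔ ownerRole M ρ φ p = π.role p.role := by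
  unfold owner
  generalize ownerRole M ρ φ p = a
  generalize p.role = b
  cases π <;> cases a <;> cases b <;> simp [Player.role, Role.dual]

/-- The formula `ψ` at `v` has the truth value wanted by `π`. -/
def IsGood (M : CKModel W At) (π : Player) (ρ : Vr → Set W) (v : W) (ψ : Formula At Vr)
    (Q : Role) : Prop :=
  π.role Q = .V ↔ v ∈ truth M ψ ρ

/-- The outermost infinitely often regenerated fixed-point formula is favourable to `π`. -/
def GoodRun (π : Player) (f : ℕ → Position W At Vr) : Prop :=
  ∃ η X ψ v Q n, IsOutermost f (.fix η X ψ) ∧ f n = .main v (.fix η X ψ) Q ∧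
    (π.role Q = .V ↔ η = .nu)

theorem regeneratedInfinitelyOften_shift {f : ℕ → Position W At Vr} (n : ℕ) :
    RegeneratedInfinitelyOften (fun i => f (n + i)) ψ ↔ RegeneratedInfinitelyOften f ψ := by
  constructor
  · rintro ⟨η, X, θ, rfl, h⟩
    refine ⟨η, X, θ, rfl, fun N => ?_⟩
    obtain ⟨m, hm, v, Q, h1, h2⟩ := h N
    exact ⟨n + m, by omega, v, Q, h1, h2⟩
  · rintro ⟨η, X, θ, rfl, h⟩
    refine ⟨η, X, θ, rfl, fun N => ?_⟩
    obtain ⟨m, hm, v, Q, h1, h2⟩ := h (n + N)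
    obtain ⟨k, rfl⟩ := Nat.exists_eq_add_of_le (le_of_add_le_left hm)
    exact ⟨k, by omega, v, Q, h1, h2⟩

theorem GoodRun.of_shift (f : ℕ → Position W At Vr) (n : ℕ)
    (h : GoodRun π fun i => f (n + i)) : GoodRun π f := by
  obtain ⟨η, X, θ, v, Q, m, ⟨h1, h2⟩, h3⟩ := h
  exact ⟨η, X, θ, v, Q, n + m, ⟨(regeneratedInfinitelyOften_shift n).1 h1,
    fun χ hχ => h2 χ ((regeneratedInfinitelyOften_shift n).2 hχ)⟩, h3⟩

/-- The positions from which `π` can win the game of `φ`, or reach `E`, inside `D`. -/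
def region (M : CKModel W At) (ρ : Vr → Set W) (φ : Formula At Vr) (π : Player)
    (D E : Set (Position W At Vr)) : Set (Position W At Vr) :=
  winSet (Move M φ) {p | owner M ρ φ p = π} (GoodRun π) D E

/-- The free variables of `ψ`, evaluated in the role `Q`, with the truth values wanted by `π`. -/
def exits (M : CKModel W At) (π : Player) (ρ : Vr → Set W) (ψ : Formula At Vr) (Q : Role) :
    Set (Position W At Vr) :=
  {p | ∃ v X Q', p = .main v (.var X) Q' ∧ ψ.FreeAt X Q Q' ∧ IsGood M π ρ v (.var X) Q'}

theorem exits_mono (h : ∀ X Q'', ψ.FreeAt X Q Q'' → θ.FreeAt X Q' Q'') :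
    exits M π ρ ψ Q ⊆ exits M π ρ θ Q' := by
  rintro p ⟨v, X, Q'', rfl, hf, hg⟩
  exact ⟨v, X, Q'', rfl, h X Q'' hf, hg⟩

/-- The positions of the game of `ψ`. -/
def positions (W : Type*) (ψ : Formula At Vr) : Set (Position W At Vr) := {p | p.InGame ψ}

theorem positions_mono (h : ψ ∈ φ.sub) : positions W ψ ⊆ positions W φ := by
  intro p hp
  cases p <;> exact sub_trans h hp

theorem main_mem_positions (v : W) (ψ : Formula At Vr) (Q : Role) :
    .main v ψ Q ∈ positions W ψ := mem_sub_self ψ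

theorem mem_region_of_step {p : Position W At Vr} (hp : p ∈ D)
    (hown : ownerRole M ρ φ p = π.role p.role → ∃ q, Move M φ p q ∧ q ∈ region M ρ φ π D E)
    (hopp : ownerRole M ρ φ p ≠ π.role p.role → ∀ q, Move M φ p q → q ∈ region M ρ φ π D E) :
    p ∈ region M ρ φ π D E :=
  mem_winSet_of_step GoodRun.of_shift hp (fun h => hown ((owner_eq_iff p).1 h))
    fun h => hopp fun h' => h ((owner_eq_iff p).2 h')

/-- All formulas are true at `v`, so goodness makes `π` Verifier, while the position is a dead end
belonging to Refuter. -/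
theorem mem_region_of_fallible (hv : v ∈ M.fallible) (hD : .main v ψ Q ∈ D)
    (hg : IsGood M π ρ' v ψ Q) : .main v ψ Q ∈ region M ρ φ π D E := by
  have hV := hg.2 (fallible_subset_truth M ψ ρ' hv)
  refine mem_region_of_step hD (fun h => ?_) fun _ q h => ?_
  · simp [ownerRole, hv, Position.role, hV] at h
  · cases h <;> contradiction

/-- Composition of games: play inside `ψ` first, and continue inside `θ` from whichever exit is
reached. -/
theorem region_of_sub {U : Set (Position W At Vr)} (hψ : ψ ∈ θ.sub)
    (hE : E ⊆ region M ρ φ π (positions W θ) U) :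
    region M ρ φ π (positions W ψ) E ⊆ region M ρ φ π (positions W θ) U :=
  (winSet_mono (positions_mono hψ) hE).trans (winSet_winSet GoodRun.of_shift)

theorem region_of_sub_exits (hψ : ψ ∈ θ.sub)
    (h : ∀ X Q'', ψ.FreeAt X Q Q'' → θ.FreeAt X Q' Q'') :
    region M ρ φ π (positions W ψ) (exits M π ρ' ψ Q) ⊆
      region M ρ φ π (positions W θ) (exits M π ρ' θ Q') :=
  winSet_mono (positions_mono hψ) (exits_mono h)

/-- The truth set of a fixed-point formula is a fixed point. -/
theorem truth_fix (η : FixKind) (X : Vr) (hp : ψ.Polar X true) :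
    truth M ψ (assign ρ X (truth M (.fix η X ψ) ρ)) = truth M (.fix η X ψ) ρ := by
  cases η
  · exact (truth_mu_isLeast M X ψ ρ hp).1
  · exact (truth_nu_isGreatest M X ψ ρ hp).1

theorem isGood_var_assign {X : Vr} {A : Set W} :
    IsGood M π (assign ρ X A) v (.var X) Q ↔ (π.role Q = .V ↔ v ∈ M.fallible ∪ A) := by
  simp [IsGood, truth, assign]

theorem isGood_var_assign_of_ne {X Y : Vr} {A : Set W} (h : Y ≠ X) :
    IsGood M π (assign ρ X A) v (.var Y) Q ↔ IsGood M π ρ v (.var Y) Q := by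
  simp [IsGood, truth, assign, h]

/-! ### Fixed-point formulas -/

section Fix

variable {η : FixKind} {X : Vr}

/-- Removing the binder adds only `X` to the exits, and by positivity `X` is met in the unchanged
role `Q`. -/
theorem exits_assign_subset {A : Set W} {U : Set (Position W At Vr)} (hp : ψ.Polar X true)
    (h : ψ.FreeAt X Q Q → ∀ v, (π.role Q = .V ↔ v ∈ M.fallible ∪ A) → .main v (.var X) Q ∈ U) :
    exits M π (assign ρ' X A) ψ Q ⊆ exits M π ρ' (.fix η X ψ) Q ∪ U := by
  rintro p ⟨v, Y, Q', rfl, hf, hg⟩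
  by_cases hY : Y = X
  · subst hY
    obtain rfl := hf.eq_of_polar.1 hp
    exact Or.inr (h hf v (isGood_var_assign.1 hg))
  · exact Or.inl ⟨v, Y, Q', rfl, ⟨Ne.symm hY, hf⟩, (isGood_var_assign_of_ne hY).1 hg⟩

theorem mem_region_of_unfold (hv : v ∉ M.fallible) (hD : .main v (.fix η X ψ) Q ∈ D)
    (h : .main v ψ Q ∈ region M ρ φ π D E) : .main v (.fix η X ψ) Q ∈ region M ρ φ π D E := by
  refine mem_region_of_step hD (fun _ => ⟨_, .unfold hv, h⟩) fun _ q hq => ?_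
  cases hq
  exact h

/-- `X` is not free in `φ` and its binder is unique, so regeneration is forced, whoever owns the
position. -/
theorem move_var_iff (hb : φ.WellBounded) (hs : .fix η X ψ ∈ φ.sub) (hf : ψ.IsFree X)
    {q : Position W At Vr} :
    Move M φ (.main v (.var X) Q) q ↔ v ∉ M.fallible ∧ q = .main v (.fix η X ψ) Q := by
  obtain ⟨-, hnf, hu⟩ := hb.of_isFree hs hf
  constructor
  · rintro (_ | _)
    rename_i ζ χ hv hX hm
    rw [hu _ _ hm]
    exact ⟨hv, rfl⟩
  · rintro ⟨hv, rfl⟩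
    exact .regenerate hv hnf hs

theorem mem_region_of_regenerate (hb : φ.WellBounded) (hs : .fix η X ψ ∈ φ.sub) (hf : ψ.IsFree X)
    (hv : v ∉ M.fallible) (hD : .main v (.var X) Q ∈ D)
    (h : .main v (.fix η X ψ) Q ∈ region M ρ φ π D E) :
    .main v (.var X) Q ∈ region M ρ φ π D E := by
  refine mem_region_of_step hD (fun _ => ⟨_, (move_var_iff hb hs hf).2 ⟨hv, rfl⟩, h⟩)
    fun _ q hq => ?_
  rw [((move_var_iff hb hs hf).1 hq).2]
  exact h

/-- The case of a least fixed point for Verifier and of a greatest fixed point for Refuter. -/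
theorem mem_region_fix_of_unfavourable (hb : φ.WellBounded) (hs : .fix η X ψ ∈ φ.sub)
    (hp : ψ.Polar X true)
    (ih : ∀ ρ' v, IsGood M π ρ' v ψ Q →
      .main v ψ Q ∈ region M ρ φ π (positions W ψ) (exits M π ρ' ψ Q))
    (hη : ¬ (π.role Q = .V ↔ η = .nu)) (hg : IsGood M π ρ' v (.fix η X ψ) Q) :
    .main v (.fix η X ψ) Q ∈
      region M ρ φ π (positions W (.fix η X ψ)) (exits M π ρ' (.fix η X ψ) Q) := by
  set U := region M ρ φ π (positions W (.fix η X ψ)) (exits M π ρ' (.fix η X ψ) Q) with hU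
  -- One application of the fixed-point operator: if the worlds with the wanted value for `A` are
  -- won, so are the infallible ones with the wanted value for its image. Play inside `ψ`, and at
  -- `X` regenerate into a position already won.
  have key : ∀ A : Set W, (∀ u, (π.role Q = .V ↔ u ∈ A) → .main u (.fix η X ψ) Q ∈ U) →
      ∀ u ∉ M.fallible, (π.role Q = .V ↔ u ∈ truth M ψ (assign ρ' X A)) →
        .main u (.fix η X ψ) Q ∈ U := by
    intro A hA u hu hgu
    refine mem_region_of_unfold hu (main_mem_positions _ _ _) (region_of_sub (Or.inr
      (mem_sub_self ψ)) ?_ (ih _ u hgu))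
    refine (exits_assign_subset hp fun hf x hx => ?_).trans
      (Set.union_subset subset_winSet (subset_refl U))
    have hD : .main x (.var X) Q ∈ positions W (.fix η X ψ) := Or.inr hf.isFree.var_mem_sub
    by_cases hxf : x ∈ M.fallible
    · exact mem_region_of_fallible (ρ' := ρ') hxf hD (by simpa [IsGood, truth, hxf] using hx)
    · exact mem_region_of_regenerate hb hs hf.isFree hxf hD (hA x (by simpa [hxf] using hx))
  by_cases hvf : v ∈ M.fallible
  · exact mem_region_of_fallible hvf (main_mem_positions _ _ _) hg
  by_cases hV : π.role Q = .V
  · cases η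
    · have hA : M.fallible ⊆ {u | .main u (.fix .mu X ψ) Q ∈ U} := fun u hu =>
        mem_region_of_fallible hu (main_mem_positions _ _ _)
          (by simpa [IsGood, hV] using fallible_subset_truth M (.fix .mu X ψ) ρ' hu)
      -- The won worlds form a prefixed point, so they include the least fixed point.
      refine Set.sInter_subset_of_mem (t := {u | .main u (.fix .mu X ψ) Q ∈ U}) ?_ (hg.1 hV)
      intro u hu
      by_cases huf : u ∈ M.fallible
      · exact hA huf
      · exact key _ (fun x hx => hx.1 hV) u huf ⟨fun _ => hu, fun _ => hV⟩
    · simp [hV] at hη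
  · cases η
    · simp [hV] at hη
    · by_contra hn
      -- Dually, the worlds not won by Refuter form a postfixed point. If `v` were among them, it
      -- would lie in the greatest fixed point, against `hg`.
      let B : Set W := {u | .main u (.fix .nu X ψ) Q ∉ U}
      refine hV (hg.2 ⟨B, ?_, hn⟩)
      intro u hu
      by_contra hut
      refine hu (key _ (fun x hx => ?_) u (fun huf => hut (fallible_subset_truth M _ _ huf))
        ⟨fun h => (hV h).elim, fun h => (hut h).elim⟩)
      by_contra hxU
      exact hV (hx.2 hxU)

/-- The case of a greatest fixed point for Verifier and of a least fixed point for Refuter. -/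
theorem mem_region_fix_of_favourable (hb : φ.WellBounded) (hs : .fix η X ψ ∈ φ.sub)
    (hp : ψ.Polar X true)
    (ih : ∀ ρ' v, IsGood M π ρ' v ψ Q →
      .main v ψ Q ∈ region M ρ φ π (positions W ψ) (exits M π ρ' ψ Q))
    (hη : π.role Q = .V ↔ η = .nu) (hg : IsGood M π ρ' v (.fix η X ψ) Q) :
    .main v (.fix η X ψ) Q ∈
      region M ρ φ π (positions W (.fix η X ψ)) (exits M π ρ' (.fix η X ψ) Q) := by
  set E := exits M π ρ' (.fix η X ψ) Q with hE
  set D := positions W (.fix η X ψ) with hD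
  -- `S` collects the good returns to `X`; one round from `ηX.ψ` ends in a win, an exit or `S`.
  let S : Set (Position W At Vr) :=
    {p | ∃ u, p = .main u (.var X) Q ∧ u ∉ M.fallible ∧ ψ.FreeAt X Q Q ∧
      IsGood M π ρ' u (.fix η X ψ) Q}
  have hfix : ∀ u, IsGood M π ρ' u (.fix η X ψ) Q →
      .main u (.fix η X ψ) Q ∈ region M ρ φ π D (E ∪ S) := by
    intro u hgu
    by_cases huf : u ∈ M.fallible
    · exact mem_region_of_fallible huf (main_mem_positions _ _ _) hgu
    -- With `X` interpreted by the truth set of `ηX.ψ`, the formulas `ψ` and `ηX.ψ` have the same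
    -- truth set by `truth_fix`, so goodness passes to the body.
    refine mem_region_of_unfold huf (main_mem_positions _ _ _) (region_of_sub (Or.inr
      (mem_sub_self ψ)) ?_ (ih (assign ρ' X (truth M (.fix η X ψ) ρ')) u ?_))
    · refine (exits_assign_subset (U := region M ρ φ π D (E ∪ S)) hp fun hf x hx => ?_).trans
        (Set.union_subset (Set.subset_union_left.trans subset_winSet) subset_rfl)
      · rw [Set.union_eq_right.2 (fallible_subset_truth M _ _)] at hx
        by_cases hxf : x ∈ M.fallible
        · exact mem_region_of_fallible (ρ' := ρ') hxf (Or.inr hf.isFree.var_mem_sub)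
            (by simpa [IsGood, truth, hxf, fallible_subset_truth M _ _ hxf] using hx)
        · exact subset_winSet (Or.inr ⟨x, rfl, hxf, hf, hx⟩)
    · rw [IsGood, truth_fix η X hp]
      exact hgu
  have hS : S ⊆ region M ρ φ π D E := by
    refine subset_winSet_of_recurrent GoodRun.of_shift ?_ ?_ ?_ ?_
    · rintro p ⟨u, rfl, hu, hf, hgu⟩
      exact Or.inr hf.isFree.var_mem_sub
    · rintro p ⟨u, rfl, hu, hf, hgu⟩
      exact ⟨_, (move_var_iff hb hs hf.isFree).2 ⟨hu, rfl⟩⟩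
    · rintro p ⟨u, rfl, hu, hf, hgu⟩ q hq
      rw [((move_var_iff hb hs hf.isFree).1 hq).2]
      exact hfix u hgu
    · intro f hfD hfM hfS
      have hreg : ∀ N, ∃ n ≥ N, ∃ u, f n = .main u (.var X) Q ∧
          f (n + 1) = .main u (.fix η X ψ) Q := by
        intro N
        obtain ⟨n, hn, u, hfn, hu, hf, hgu⟩ := hfS N
        have := hfM n
        rw [hfn] at this
        exact ⟨n, hn, u, hfn, ((move_var_iff hb hs hf.isFree).1 this).2⟩
      obtain ⟨n, -, u, -, hn⟩ := hreg 0
      refine ⟨η, X, ψ, u, Q, n + 1, ⟨⟨η, X, ψ, rfl, fun N => ?_⟩, ?_⟩, hn, hη⟩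
      · obtain ⟨m, hm, x, h⟩ := hreg N
        exact ⟨m, hm, x, Q, h⟩
      -- The run stays among positions of `ηX.ψ`, so any other regenerated formula is a subformula
      -- of it.
      · rintro χ ⟨ζ, Y, θ, rfl, h⟩
        obtain ⟨m, -, x, Q', -, hm⟩ := h 0
        have := hfD (m + 1)
        rw [hm] at this
        exact this
  exact winSet_winSet GoodRun.of_shift (winSet_mono subset_rfl
    (Set.union_subset subset_winSet hS) (hfix v hg))

end Fix

/-- Moves and owners are always those of the game of `φ`; only the domain and the exits shrink to
`ψ`. The interpretation `ρ'` must vary because fixed points reassign `X`, and `Q` because negations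
and antecedents swap roles. Variables are exits, so their case is immediate. -/
theorem mem_region_of_isGood (hφ : φ.WellFormed) (hb : φ.WellBounded) (hψ : ψ ∈ φ.sub)
    (hg : IsGood M π ρ' v ψ Q) :
    .main v ψ Q ∈ region M ρ φ π (positions W ψ) (exits M π ρ' ψ Q) := by
  induction ψ generalizing ρ' v Q with
  | prop P =>
    refine mem_region_of_step (main_mem_positions _ _ _) (fun h => ?_) fun _ q h => by cases h
    simp only [IsGood, truth] at hg
    have := M.fallible_val P
    by_cases hV : π.role Q = .V <;> simp_all [ownerRole, formulaOwner, Position.role]; grind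
  | var X => exact subset_winSet ⟨v, X, Q, rfl, ⟨rfl, rfl⟩, hg⟩
  | bot =>
    refine mem_region_of_step (main_mem_positions _ _ _) (fun h => ?_) fun _ q h => by cases h
    simp only [IsGood, truth] at hg
    by_cases hV : π.role Q = .V <;> simp_all [ownerRole, formulaOwner, Position.role]
  | top =>
    refine mem_region_of_step (main_mem_positions _ _ _) (fun h => ?_) fun _ q h => by cases h
    simp only [IsGood, truth, Set.mem_univ, iff_true] at hg
    simp [ownerRole, formulaOwner, Position.role, hg] at h
  | neg θ ih =>
    by_cases hv : v ∈ M.fallible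
    · exact mem_region_of_fallible hv (main_mem_positions _ _ _) hg
    have ih' := fun u (h : IsGood M π ρ' u θ Q.dual) =>
      region_of_sub_exits (θ := .neg θ) (Q' := Q) (Or.inr (mem_sub_self θ)) (fun _ _ h => h)
        (ih (sub_trans hψ (Or.inr (mem_sub_self _))) h)
    simp only [IsGood, truth, Set.mem_union, hv, false_or, Set.mem_ofPred_eq] at hg
    refine mem_region_of_step (main_mem_positions _ _ _) (fun h => ?_) (fun h q hq => ?_)
    -- At a Refuter position, `π` moves exactly when not Verifier: then `π` wants falsity and picks
    -- a witness of it, and otherwise truth survives every move.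
    all_goals simp only [ownerRole, hv, if_false, formulaOwner, Position.role, Role.eq_R_iff, ne_eq,
      not_not] at h
    · have := mt hg.2 h
      push Not at this
      obtain ⟨u, hu, hut⟩ := this
      exact ⟨_, .neg hv hu, ih' u (by simp [IsGood, Player.role_dual_eq_V, h, hut])⟩
    · cases hq
      rename_i u _ hu
      exact ih' u (by simp [IsGood, Player.role_dual_eq_V, h, hg.1 h u hu])
  | and θ₁ θ₂ ih₁ ih₂ =>
    by_cases hv : v ∈ M.fallible
    · exact mem_region_of_fallible hv (main_mem_positions _ _ _) hg
    have ih₁' := fun (h : IsGood M π ρ' v θ₁ Q) =>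
      region_of_sub_exits (θ := .and θ₁ θ₂) (Q' := Q) (Or.inr (Or.inl (mem_sub_self _)))
        (fun _ _ => Or.inl) (ih₁ (sub_trans hψ (Or.inr (Or.inl (mem_sub_self _)))) h)
    have ih₂' := fun (h : IsGood M π ρ' v θ₂ Q) =>
      region_of_sub_exits (θ := .and θ₁ θ₂) (Q' := Q) (Or.inr (Or.inr (mem_sub_self _)))
        (fun _ _ => Or.inr) (ih₂ (sub_trans hψ (Or.inr (Or.inr (mem_sub_self _)))) h)
    simp only [IsGood, truth, Set.mem_inter_iff] at hg ih₁' ih₂'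
    refine mem_region_of_step (main_mem_positions _ _ _) (fun h => ?_) (fun h q hq => ?_)
    all_goals simp only [ownerRole, hv, if_false, formulaOwner, Position.role, Role.eq_R_iff, ne_eq,
      not_not] at h
    · by_cases h₁ : v ∈ truth M θ₁ ρ'
      · exact ⟨_, .and_right hv, ih₂' (by tauto)⟩
      · exact ⟨_, .and_left hv, ih₁' (by tauto)⟩
    · cases hq
      · exact ih₁' (by tauto)
      · exact ih₂' (by tauto)
  | or θ₁ θ₂ ih₁ ih₂ =>
    by_cases hv : v ∈ M.fallible
    · exact mem_region_of_fallible hv (main_mem_positions _ _ _) hg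
    have ih₁' := fun (h : IsGood M π ρ' v θ₁ Q) =>
      region_of_sub_exits (θ := .or θ₁ θ₂) (Q' := Q) (Or.inr (Or.inl (mem_sub_self _)))
        (fun _ _ => Or.inl) (ih₁ (sub_trans hψ (Or.inr (Or.inl (mem_sub_self _)))) h)
    have ih₂' := fun (h : IsGood M π ρ' v θ₂ Q) =>
      region_of_sub_exits (θ := .or θ₁ θ₂) (Q' := Q) (Or.inr (Or.inr (mem_sub_self _)))
        (fun _ _ => Or.inr) (ih₂ (sub_trans hψ (Or.inr (Or.inr (mem_sub_self _)))) h)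
    simp only [IsGood, truth, Set.mem_union] at hg ih₁' ih₂'
    refine mem_region_of_step (main_mem_positions _ _ _) (fun h => ?_) (fun h q hq => ?_)
    all_goals simp only [ownerRole, hv, if_false, formulaOwner, Position.role, ne_eq,
      eq_comm (a := Role.V)] at h
    · by_cases h₁ : v ∈ truth M θ₁ ρ'
      · exact ⟨_, .or_left hv, ih₁' (by tauto)⟩
      · exact ⟨_, .or_right hv, ih₂' (by tauto)⟩
    · cases hq
      · exact ih₁' (by tauto)
      · exact ih₂' (by tauto)
  | imp θ₁ θ₂ ih₁ ih₂ =>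
    by_cases hv : v ∈ M.fallible
    · exact mem_region_of_fallible hv (main_mem_positions _ _ _) hg
    have ih₁' := fun u (h : IsGood M π ρ' u θ₁ Q.dual) =>
      region_of_sub_exits (θ := .imp θ₁ θ₂) (Q' := Q) (Or.inr (Or.inl (mem_sub_self _)))
        (fun _ _ => Or.inl) (ih₁ (sub_trans hψ (Or.inr (Or.inl (mem_sub_self _)))) h)
    have ih₂' := fun u (h : IsGood M π ρ' u θ₂ Q) =>
      region_of_sub_exits (θ := .imp θ₁ θ₂) (Q' := Q) (Or.inr (Or.inr (mem_sub_self _)))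
        (fun _ _ => Or.inr) (ih₂ (sub_trans hψ (Or.inr (Or.inr (mem_sub_self _)))) h)
    simp only [IsGood, Player.role_dual_eq_V] at ih₁' ih₂'
    -- The auxiliary position tests the implication at the single world `u`, which may be fallible:
    -- auxiliary positions keep their moves there.
    have aux : ∀ u, (π.role Q = .V ↔ (u ∈ truth M θ₁ ρ' → u ∈ truth M θ₂ ρ')) →
        .imp u θ₁ θ₂ Q ∈ region M ρ φ π (positions W (.imp θ₁ θ₂))
          (exits M π ρ' (.imp θ₁ θ₂) Q) := by
      intro u hu
      refine mem_region_of_step (mem_sub_self (.imp θ₁ θ₂)) (fun h => ?_) (fun h q hq => ?_)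
      all_goals simp only [ownerRole, Position.role, ne_eq, eq_comm (a := Role.V)] at h
      · by_cases h₁ : u ∈ truth M θ₁ ρ'
        · exact ⟨_, .imp_right, ih₂' u (by tauto)⟩
        · exact ⟨_, .imp_left, ih₁' u (by tauto)⟩
      · cases hq
        · exact ih₁' u (by tauto)
        · exact ih₂' u (by tauto)
    simp only [IsGood, truth, Set.mem_ofPred_eq] at hg
    refine mem_region_of_step (main_mem_positions _ _ _) (fun h => ?_) (fun h q hq => ?_)
    all_goals simp only [ownerRole, hv, if_false, formulaOwner, Position.role, Role.eq_R_iff, ne_eq,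
      not_not] at h
    · have := mt hg.2 h
      push Not at this
      obtain ⟨u, hu, hut⟩ := this
      exact ⟨_, .imp hv hu, aux u (by tauto)⟩
    · cases hq
      rename_i u _ hu
      exact aux u ⟨fun _ => hg.1 h u hu, fun _ => h⟩
  | box θ ih =>
    by_cases hv : v ∈ M.fallible
    · exact mem_region_of_fallible hv (main_mem_positions _ _ _) hg
    have ih' := fun u (h : IsGood M π ρ' u θ Q) =>
      region_of_sub_exits (θ := .box θ) (Q' := Q) (Or.inr (mem_sub_self θ)) (fun _ _ h => h)
        (ih (sub_trans hψ (Or.inr (mem_sub_self _))) h)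
    have aux : ∀ u, (π.role Q = .V ↔ ∀ x, M.R u x → x ∈ truth M θ ρ') →
        .box u θ Q ∈ region M ρ φ π (positions W (.box θ)) (exits M π ρ' (.box θ) Q) := by
      intro u hu
      refine mem_region_of_step (mem_sub_self (.box θ)) (fun h => ?_) (fun h q hq => ?_)
      all_goals simp only [ownerRole, Position.role, Role.eq_R_iff, ne_eq, not_not] at h
      · have := mt hu.2 h
        push Not at this
        obtain ⟨x, hx, hxt⟩ := this
        exact ⟨_, .box_step hx, ih' x (by simp [IsGood, h, hxt])⟩
      · cases hq
        rename_i x hx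
        exact ih' x (by simp [IsGood, h, hu.1 h x hx])
    simp only [IsGood, truth, Set.mem_ofPred_eq] at hg
    refine mem_region_of_step (main_mem_positions _ _ _) (fun h => ?_) (fun h q hq => ?_)
    all_goals simp only [ownerRole, hv, if_false, formulaOwner, Position.role, Role.eq_R_iff, ne_eq,
      not_not] at h
    · have := mt hg.2 h
      push Not at this
      obtain ⟨u, x, hu, hx, hxt⟩ := this
      exact ⟨_, .box hv hu, aux u ⟨fun h' => (h h').elim, fun h' => (hxt (h' x hx)).elim⟩⟩
    · cases hq
      rename_i u _ hu
      exact aux u ⟨fun _ x hx => hg.1 h u x hu hx, fun _ => h⟩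
  | dia θ ih =>
    by_cases hv : v ∈ M.fallible
    · exact mem_region_of_fallible hv (main_mem_positions _ _ _) hg
    have ih' := fun u (h : IsGood M π ρ' u θ Q) =>
      region_of_sub_exits (θ := .dia θ) (Q' := Q) (Or.inr (mem_sub_self θ)) (fun _ _ h => h)
        (ih (sub_trans hψ (Or.inr (mem_sub_self _))) h)
    have aux : ∀ u, (π.role Q = .V ↔ ∃ x, M.R u x ∧ x ∈ truth M θ ρ') →
        .dia u θ Q ∈ region M ρ φ π (positions W (.dia θ)) (exits M π ρ' (.dia θ) Q) := by
      intro u hu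
      refine mem_region_of_step (mem_sub_self (.dia θ)) (fun h => ?_) (fun h q hq => ?_)
      all_goals simp only [ownerRole, Position.role, ne_eq, eq_comm (a := Role.V)] at h
      · obtain ⟨x, hx, hxt⟩ := hu.1 h
        exact ⟨_, .dia_step hx, ih' x (by simp [IsGood, h, hxt])⟩
      · cases hq
        rename_i x hx
        exact ih' x ⟨fun h' => (h h').elim, fun hxt => hu.2 ⟨x, hx, hxt⟩⟩
    simp only [IsGood, truth, Set.mem_union, hv, false_or, Set.mem_ofPred_eq] at hg
    refine mem_region_of_step (main_mem_positions _ _ _) (fun h => ?_) (fun h q hq => ?_)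
    all_goals simp only [ownerRole, hv, if_false, formulaOwner, Position.role, Role.eq_R_iff, ne_eq,
      not_not] at h
    · have := mt hg.2 h
      push Not at this
      obtain ⟨u, hu, hut⟩ := this
      exact ⟨_, .dia hv hu, aux u ⟨fun h' => (h h').elim,
        fun ⟨x, hx, hxt⟩ => (hut x hx hxt).elim⟩⟩
    · cases hq
      rename_i u _ hu
      exact aux u ⟨fun _ => hg.1 h u hu, fun _ => h⟩
  | fix η X θ ih =>
    have hp := hφ η X θ hψ
    have ih' := fun ρ' v (h : IsGood M π ρ' v θ Q) =>
      ih (sub_trans hψ (Or.inr (mem_sub_self _))) h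
    by_cases hη : π.role Q = .V ↔ η = .nu
    · exact mem_region_fix_of_favourable hb hψ hp ih' hη hg
    · exact mem_region_fix_of_unfavourable hb hψ hp ih' hη hg

theorem Move.inGame {p q : Position W At Vr} (h : Move M φ p q) (hp : p.InGame φ) :
    q.InGame φ := by
  cases h <;> first
    | assumption
    | exact sub_trans hp (Or.inr (mem_sub_self _))
    | exact sub_trans hp (Or.inr (Or.inl (mem_sub_self _)))
    | exact sub_trans hp (Or.inr (Or.inr (mem_sub_self _)))

/-- For the whole formula `φ` and its actual interpretation, exits are dead ends; by
`owner_ne_of_mem_exits` they are lost by the opponent, so reaching one is a win. -/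
theorem not_move_of_mem_exits {p q : Position W At Vr} (hp : p ∈ exits M π ρ φ Q) :
    ¬ Move M φ p q := by
  obtain ⟨v, X, Q', rfl, hf, -⟩ := hp
  rintro (_ | _)
  exact absurd hf.isFree ‹_›

theorem owner_ne_of_mem_exits {p : Position W At Vr} (hp : p ∈ exits M π ρ φ Q) :
    owner M ρ φ p ≠ π := by
  obtain ⟨v, X, Q', rfl, hf, hg⟩ := hp
  rw [ne_eq, owner_eq_iff]
  simp only [IsGood, truth] at hg
  by_cases hV : π.role Q' = .V <;>
    simp_all [ownerRole, formulaOwner, Position.role, hf.isFree] <;> grind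

end Region

/-! ### Ownership of fixed points and winning strategies -/

section Strategy

variable {W At Vr : Type*} {M : CKModel W At} {ρ : Vr → Set W} {φ ψ : Formula At Vr}
  {π : Player} {v w : W} {Q Q' : Role} {f : ℕ → Position W At Vr}

/-- The formula at the position occurs in `φ` with the polarity given by the role. -/
def Position.Polarized (φ : Formula At Vr) : Position W At Vr → Prop
  | .main _ ψ Q => OccursAt ψ φ .V Q
  | .dia _ ψ Q => OccursAt (.dia ψ) φ .V Q
  | .box _ ψ Q => OccursAt (.box ψ) φ .V Q
  | .imp _ θ θ' Q => OccursAt (.imp θ θ') φ .V Q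

/-- All moves but regeneration descend along an occurrence. Regeneration jumps from the positive `X`
back to its binder, which has the same role. -/
theorem Move.polarized (hφ : φ.WellFormed) (hb : φ.WellBounded) {p q : Position W At Vr}
    (h : Move M φ p q) (hp : p.InGame φ) (hpol : p.Polarized φ) : q.Polarized φ := by
  cases h with
  | imp | dia | box => exact hpol
  | @regenerate v η X ψ Q _ hnf hs =>
    rcases isFree_or_exists_fix hp with h | ⟨ζ, θ, hθ, hf⟩
    · exact (hnf h).elim
    obtain ⟨ho, -, hu⟩ := hb.of_isFree hθ hf
    rw [hu _ _ hs]
    obtain ⟨Q', hQ'⟩ := exists_occursAt hθ .V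
    have hX : OccursAt (.var X) φ .V Q' :=
      hQ'.trans (Or.inr ((hf.occursAt_of_polar Q').1 (hφ _ _ _ hθ)))
    -- The only occurrence of `X` has role `Q` by the invariant and role `Q'` through the binder, so
    -- the two agree.
    exact OccursAt.unique ho.le hX hpol ▸ hQ'
  | or_left | and_left | imp_left => exact OccursAt.trans hpol (Or.inr (Or.inl (occursAt_self _ _)))
  | or_right | and_right | imp_right =>
    exact OccursAt.trans hpol (Or.inr (Or.inr (occursAt_self _ _)))
  | neg | dia_step | box_step | unfold => exact OccursAt.trans hpol (Or.inr (occursAt_self _ _))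

theorem inGame_and_polarized_of_reachable (hφ : φ.WellFormed) (hb : φ.WellBounded)
    {p : Position W At Vr} (h : Relation.ReflTransGen (Move M φ) (start w φ) p) :
    p.InGame φ ∧ p.Polarized φ := by
  induction h with
  | refl => exact ⟨mem_sub_self φ, occursAt_self φ .V⟩
  | tail _ h ih => exact ⟨h.inGame ih.1, h.polarized hφ hb ih.1 ih.2⟩

/-- The positive variable `X` inherits the role of its binder, and its single occurrence in `φ`
admits only one role. -/
theorem role_eq_of_reachable (hφ : φ.WellFormed) (hb : φ.WellBounded) {η : FixKind} {X : Vr}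
    {u : W} (hf : ψ.IsFree X)
    (h : Relation.ReflTransGen (Move M φ) (start w φ) (.main v (.fix η X ψ) Q))
    (h' : Relation.ReflTransGen (Move M φ) (start w φ) (.main u (.fix η X ψ) Q')) : Q = Q' := by
  obtain ⟨hs, h⟩ := inGame_and_polarized_of_reachable hφ hb h
  obtain ⟨-, h'⟩ := inGame_and_polarized_of_reachable hφ hb h'
  have hX (Q) : OccursAt (.var X) (.fix η X ψ) Q Q :=
    Or.inr ((hf.occursAt_of_polar Q).1 (hφ _ _ _ hs))
  exact OccursAt.unique (hb.of_isFree hs hf).1.le (OccursAt.trans h (hX Q))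
    (OccursAt.trans h' (hX Q'))

theorem IsInfiniteRun.reachable (h : IsInfiniteRun M w φ f) (n : ℕ) :
    Relation.ReflTransGen (Move M φ) (start w φ) (f n) := by
  induction n with
  | zero => rw [h.1]
  | succ n ih => exact ih.tail (h.2 n)

theorem IsOutermost.unique {χ χ' : Formula At Vr} (h : IsOutermost f χ) (h' : IsOutermost f χ') :
    χ = χ' :=
  sub_antisymm (h'.2 χ h.1) (h.2 χ' h'.1)

theorem IsInfiniteRun.isFree_of_regenerated (hφ : φ.WellFormed) (hb : φ.WellBounded)
    (h : IsInfiniteRun M w φ f) {η : FixKind} {X : Vr}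
    (hr : RegeneratedInfinitelyOften f (.fix η X ψ)) : ψ.IsFree X := by
  obtain ⟨η', X', ψ', he, hr⟩ := hr
  obtain ⟨rfl, rfl, rfl⟩ := Formula.fix.inj he
  obtain ⟨n, -, v, Q, h1, h2⟩ := hr 0
  have hm := h.2 n
  have hg := (inGame_and_polarized_of_reachable hφ hb (h.reachable n)).1
  rw [h1, h2] at hm
  rw [h1] at hg
  cases hm with
  | regenerate _ hnf hs =>
    rcases isFree_or_exists_fix hg with hF | ⟨ζ, θ, hθ, hf⟩
    · exact (hnf hF).elim
    · obtain ⟨-, -, rfl⟩ := Formula.fix.inj ((hb.of_isFree hθ hf).2.2 _ _ hs)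
      exact hf

/-- For `I`, the position on the run witnesses ownership. For `II`, one must exclude every other
witness: the outermost formula is unique, and so is the role in which it is reached. -/
theorem GoodRun.winsInfinite (hφ : φ.WellFormed) (hb : φ.WellBounded)
    (h : IsInfiniteRun M w φ f) (hg : GoodRun π f) : WinsInfinite M w φ f π := by
  obtain ⟨η, X, ψ, v, Q, n, ho, hn, hη⟩ := hg
  have hreach := h.reachable n
  rw [hn] at hreach
  cases π
  · refine ⟨_, ho, v, Q, X, ψ, hreach, ?_⟩
    cases Q <;> cases η <;> simp_all [Player.role]
  · rintro ⟨χ, hχ, u, Q', Y, θ, hreach', hQ'⟩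
    obtain rfl := ho.unique hχ
    obtain rfl := role_eq_of_reachable hφ hb (h.isFree_of_regenerated hφ hb ho.1) hreach hreach'
    cases Q <;> cases η <;> simp_all [Player.role, Role.dual]

theorem hasWinningStrategy_of_isGood (hφ : φ.WellFormed) (hb : φ.WellBounded)
    (hg : IsGood M π ρ w φ .V) : HasWinningStrategy M ρ w φ π := by
  classical
  obtain ⟨U, σ, h, hw⟩ := mem_region_of_isGood (ρ' := ρ) hφ hb (mem_sub_self φ) hg
  set E := exits M π ρ φ .V
  -- `σ` is known to be admissible only inside the trap, whereas a strategy must be so at every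
  -- owned position; elsewhere `τ` picks an arbitrary move.
  let τ : Position W At Vr → Position W At Vr := fun p =>
    if Move M φ p (σ p) then σ p else if h : ∃ q, Move M φ p q then h.choose else p
  have hτ : ∀ p ∈ U, p ∉ E → owner M ρ φ p = π → τ p = σ p := fun p hp hE ho =>
    if_pos (h.own p hp hE ho).1
  have hE : ∀ p q, Move M φ p q → p ∉ E := fun p q hm hp => not_move_of_mem_exits hp hm
  refine ⟨τ, fun p _ _ hq => ?_, fun n f hf hs ho => ?_, fun f hf hs => ?_⟩
  · by_cases hσ : Move M φ p (σ p)
    · simpa only [τ, if_pos hσ] using hσ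
    · simpa only [τ, if_neg hσ, dif_pos hq] using hq.choose_spec
  · have hU : ∀ i ≤ n, f i ∈ U := by
      intro i
      induction i with
      | zero => intro _; rw [hf.1]; exact hw
      | succ i ih =>
        intro hi
        have hm := hf.2.1 i hi
        exact h.next (ih (by omega)) (hE _ _ hm) hm
          fun ho => (hs i hi ho).trans (hτ _ (ih (by omega)) (hE _ _ hm) ho)
    -- If the run stops outside the exits, `π` cannot own the last position, as `σ` would supply a
    -- move.
    by_cases hnE : f n ∈ E
    · exact owner_ne_of_mem_exits hnE ho
    · exact hf.2.2 ⟨_, (h.own _ (hU n le_rfl) hnE ho).1⟩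
  · have hU : ∀ i, f i ∈ U := by
      intro i
      induction i with
      | zero => rw [hf.1]; exact hw
      | succ i ih =>
        exact h.next ih (hE _ _ (hf.2 i)) (hf.2 i)
          fun ho => (hs i ho).trans (hτ _ ih (hE _ _ (hf.2 i)) ho)
    exact (h.good f (fun i => ⟨hU i, hE _ _ (hf.2 i)⟩) hf.2 fun i ho =>
      (hs i ho).trans (hτ _ (hU i) (hE _ _ (hf.2 i)) ho)).winsInfinite hφ hb hf

/-- Let the strategies play each other: a finite run is lost by the owner of its last position, and
an infinite one cannot be won by both. -/
theorem not_both_hasWinningStrategy (h₁ : HasWinningStrategy M ρ w φ .I)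
    (h₂ : HasWinningStrategy M ρ w φ .II) : False := by
  classical
  obtain ⟨σ₁, hs₁, hfin₁, hinf₁⟩ := h₁
  obtain ⟨σ₂, hs₂, hfin₂, hinf₂⟩ := h₂
  let τ : Position W At Vr → Position W At Vr := fun p =>
    if owner M ρ φ p = .I then σ₁ p else σ₂ p
  let f : ℕ → Position W At Vr := fun n => τ^[n] (start w φ)
  have hf : ∀ i, f (i + 1) = τ (f i) := fun i => Function.iterate_succ_apply' τ i _
  have hI : ∀ i, owner M ρ φ (f i) = .I → f (i + 1) = σ₁ (f i) := fun i ho => by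
    rw [hf]; exact if_pos ho
  have hII : ∀ i, owner M ρ φ (f i) = .II → f (i + 1) = σ₂ (f i) := fun i ho => by
    rw [hf]; exact if_neg (by simp [ho])
  have hstep : ∀ i, (f i).InGame φ → (∃ q, Move M φ (f i) q) → Move M φ (f i) (f (i + 1)) := by
    intro i hi hq
    cases ho : owner M ρ φ (f i)
    · rw [hI i ho]; exact hs₁ _ hi ho hq
    · rw [hII i ho]; exact hs₂ _ hi ho hq
  have hgame : ∀ n, (∀ i < n, ∃ q, Move M φ (f i) q) → (f n).InGame φ := by
    intro n
    induction n with
    | zero => intro _; exact mem_sub_self φ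
    | succ n ih =>
      intro hn
      have hg := ih fun i hi => hn i (by omega)
      exact (hstep n hg (hn n (by omega))).inGame hg
  -- The sequence `f` is defined even past a dead end; only its part up to the first dead end is a
  -- run.
  by_cases hstuck : ∃ n, ¬ ∃ q, Move M φ (f n) q
  · have hbefore : ∀ i < Nat.find hstuck, ∃ q, Move M φ (f i) q := fun i hi =>
      not_not.1 (Nat.find_min hstuck hi)
    have hrun : IsFiniteRun M w φ (Nat.find hstuck) f :=
      ⟨rfl, fun i hi => hstep i (hgame i fun j hj => hbefore j (hj.trans hi)) (hbefore i hi),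
        Nat.find_spec hstuck⟩
    cases ho : owner M ρ φ (f (Nat.find hstuck))
    · exact hfin₁ _ f hrun (fun i _ => hI i) ho
    · exact hfin₂ _ f hrun (fun i _ => hII i) ho
  · push Not at hstuck
    have hrun : IsInfiniteRun M w φ f :=
      ⟨rfl, fun i => hstep i (hgame i fun j _ => hstuck j) (hstuck i)⟩
    exact hinf₂ f hrun hII (hinf₁ f hrun hI)

end Strategy

end ConstructiveMu

theorem mainTheorem1 {W At Vr : Type*} (M : ConstructiveMu.CKModel W At) (ρ : Vr → Set W)
    (w : W) (φ : ConstructiveMu.Formula At Vr) (hφ : φ.WellFormed) (hn : φ.WellNamed) :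
    (ConstructiveMu.HasWinningStrategy M ρ w φ .I ↔ w ∈ ConstructiveMu.truth M φ ρ) ∧
    (ConstructiveMu.HasWinningStrategy M ρ w φ .II ↔ w ∉ ConstructiveMu.truth M φ ρ) := by
  have h₁ : w ∈ ConstructiveMu.truth M φ ρ → ConstructiveMu.HasWinningStrategy M ρ w φ .I :=
    fun h => ConstructiveMu.hasWinningStrategy_of_isGood hφ hn.2
      (by simpa [ConstructiveMu.IsGood, ConstructiveMu.Player.role] using h)
  have h₂ : w ∉ ConstructiveMu.truth M φ ρ → ConstructiveMu.HasWinningStrategy M ρ w φ .II :=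
    fun h => ConstructiveMu.hasWinningStrategy_of_isGood hφ hn.2
      (by simpa [ConstructiveMu.IsGood, ConstructiveMu.Player.role, ConstructiveMu.Role.dual]
        using h)
  refine ⟨⟨fun h => ?_, h₁⟩, fun h hw => ConstructiveMu.not_both_hasWinningStrategy (h₁ hw) h, h₂⟩
  by_contra hw
  exact ConstructiveMu.not_both_hasWinningStrategy h (h₂ hw)
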